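/- Let $R=\mathbb F_2\bigl[z,\tfrac1{z(1+z^3)}\bigr]$, let $\mathfrak O=R\oplus R\,I\oplus R\,J\oplus R\,IJ$ be the $R$-order in the quaternion algebra $\bigl[\tfrac{z,\,1+z^3}{\mathbb F_2(z)}\bigr)$ with $I^2+I=z$, $J^2=1+z^3$, $JI=(I+1)J$, and let $G(R)=\mathfrak O^\times/R^\times$. Let $b_1,b_2,c_1,c_2,d\in G(R)$ be the classes of the units $$B_1=(1+z)I+J,\quad B_2=z+z^2+(1+z)I+J+IJ,\quad C_1=1+z^2+IJ,\quad C_2=z+z^2+IJ,\quad D=1+z+z^2+IJ$$ of $\mathfrak O$. Then $G(R)$ has, on these elements, the presentation $$G(R)=\left\langle b_1,b_2,c_1,c_2,d\ \left|\ \begin{array}{c}c_1^2,\ c_2^2,\ d^2,\ c_1c_2=c_2c_1,\ c_1d=dc_1,\ c_2d=dc_2,\\ b_1b_2c_1b_2,\ b_1c_2b_1b_2^{-1},\ db_1db_1,\ db_2db_2\end{array}\right.\right\rangle .$$ Moreover, put $\Lambda=\langle b_1,b_2,c_1,c_2\rangle\le G(R)$. Then $\Lambda$ is normal in $G(R)$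 and $G(R)$ is the internal semidirect product $\Lambda\rtimes\langle d\rangle$. The subgroup $\langle d\rangle$ has order $2$ and is the stabilizer in $G(R)$ of the standard vertex of the product of the Bruhat--Tits trees of $\mathrm{PGL}_2(\mathbb F_2((y)))$ and $\mathrm{PGL}_2(\mathbb F_2((t)))$, where $y^2+y=z$ and $t^2+t=u:=z^{-1}$. Here the standard vertex is the pair of homothety classes of $\mathbb F_2[[y]]^2$ and $\mathbb F_2[[t]]^2$, and $G(R)$ acts through the splittings $$\rho_y:\ I\mapsto\begin{pmatrix}y&0\\0&1+y\end{pmatrix},\ J\mapsto\begin{pmatrix}0&1+z^3\\1&0\end{pmatrix};\qquad \rho_t:\ I\mapsto\begin{pmatrix}1+u+t&1+u^3\\u^{-1}&u+t\end{pmatrix},\ J\mapsto\begin{pmatrix}0&u^{-1}+u^2\\u^{-2}&0\end{pmatrix}.$$ -/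

import Mathlib

noncomputable section

namespace QuatLattice

open Polynomial

/-! ### The order and its unit group modulo scalars -/

/-- For a commutative ring `A` and `ζ : A`, the algebra `A ⊕ A·I ⊕ A·J ⊕ A·IJ` with
`I² = ζ + I`, `J² = 1 + ζ³` and `JI = J - IJ`. In characteristic two these relations read
`I² + I = ζ`, `J² = 1 + ζ³` and `JI = (I+1)J`. The element `⟨x₀, x₁, x₂, x₃⟩` is
`x₀ + x₁ I + x₂ J + x₃ IJ`. -/
abbrev Quat (A : Type) [CommRing A] (ζ : A) : Type := QuaternionAlgebra A ζ 1 (1 + ζ ^ 3)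

section Quat

variable {A : Type} [CommRing A] {ζ : A}

/-- The reduced norm. -/
def nrd (x : Quat A ζ) : A :=
  x.re ^ 2 + x.re * x.imI - ζ * x.imI ^ 2
    - (1 + ζ ^ 3) * (x.imJ ^ 2 + x.imJ * x.imK - ζ * x.imK ^ 2)

theorem mul_star_eq (x : Quat A ζ) : x * star x = algebraMap A (Quat A ζ) (nrd x) := by
  ext <;> simp [nrd, QuaternionAlgebra.algebraMap_eq] <;> ring

theorem star_mul_eq (x : Quat A ζ) : star x * x = algebraMap A (Quat A ζ) (nrd x) := by
  ext <;> simp [nrd, QuaternionAlgebra.algebraMap_eq] <;> ring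

/-- An element whose reduced norm has the inverse `c`, as a unit. -/
def unitOfNrd (x : Quat A ζ) (c : A) (h : nrd x * c = 1) : (Quat A ζ)ˣ where
  val := x
  inv := c • star x
  val_inv := by
    rw [mul_smul_comm, mul_star_eq, Algebra.smul_def, ← map_mul, mul_comm, h, map_one]
  inv_val := by
    rw [smul_mul_assoc, star_mul_eq, Algebra.smul_def, ← map_mul, mul_comm, h, map_one]

variable (A ζ) in
/-- The subgroup `Aˣ` of scalar units. -/
def scalarUnits : Subgroup (Quat A ζ)ˣ :=
  (Units.map (algebraMap A (Quat A ζ)).toMonoidHom).range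

instance : (scalarUnits A ζ).Normal where
  conj_mem := by
    rintro _ ⟨a, rfl⟩ g
    refine ⟨a, ?_⟩
    rw [eq_mul_inv_iff_mul_eq]
    ext1
    exact Algebra.commutes (a : A) (g : Quat A ζ)

end Quat

/-- The ring `R = 𝔽₂[z, 1/(z(1+z³))]`. -/
abbrev CoeffRing : Type := Localization.Away (X * (1 + X ^ 3) : (ZMod 2)[X])

/-- The parameter `z`, as an element of `R`. -/
def z : CoeffRing := algebraMap (ZMod 2)[X] CoeffRing X

/-- The element `1/(z(1+z³))` of `R`. -/
def w : CoeffRing := IsLocalization.Away.invSelf (X * (1 + X ^ 3) : (ZMod 2)[X])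

theorem z_mul_w : z * (1 + z ^ 3) * w = 1 := by
  have h := IsLocalization.Away.mul_invSelf (S := CoeffRing)
    (X * (1 + X ^ 3) : (ZMod 2)[X])
  simpa [z, w] using h

theorem two_eq_zero : (2 : CoeffRing) = 0 := by
  have h : (2 : (ZMod 2)[X]) = 0 := CharTwo.two_eq_zero
  have := congrArg (algebraMap (ZMod 2)[X] CoeffRing) h
  rwa [map_ofNat, map_zero] at this

/-- The order `𝔒 = R ⊕ R·I ⊕ R·J ⊕ R·IJ` in the quaternion algebra `[z, 1+z³)`. -/
abbrev Order : Type := Quat CoeffRing z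

/-- The group `G(R) = 𝔒ˣ / Rˣ`. -/
abbrev G : Type := Orderˣ ⧸ scalarUnits CoeffRing z

/-- `B₁ = (1+z)I + J`, of reduced norm `1+z`. -/
def B₁ : Orderˣ := unitOfNrd ⟨0, 1 + z, 1, 0⟩ (z * (1 + z + z ^ 2) * w) (by
  simp only [nrd]
  linear_combination z_mul_w +
    (-(z * w) - z ^ 2 * w - z ^ 3 * w * 2 - z ^ 4 * w * 3 - z ^ 5 * w * 2 - z ^ 6 * w) * two_eq_zero)

/-- `B₂ = z + z² + (1+z)I + J + IJ`, of reduced norm `z+z²`. -/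
def B₂ : Orderˣ := unitOfNrd ⟨z + z ^ 2, 1 + z, 1, 1⟩ ((1 + z + z ^ 2) * w) (by
  simp only [nrd]
  linear_combination z_mul_w +
    (-(z * w) + z ^ 3 * w + z ^ 4 * w + z ^ 5 * w + z ^ 6 * w - w) * two_eq_zero)

/-- `C₁ = 1 + z² + IJ`, of reduced norm `1+z`. -/
def C₁ : Orderˣ := unitOfNrd ⟨1 + z ^ 2, 0, 0, 1⟩ (z * (1 + z + z ^ 2) * w) (by
  simp only [nrd]
  linear_combination z_mul_w +
    (z ^ 2 * w + z ^ 3 * w * 2 + z ^ 4 * w + z ^ 5 * w * 2 + z ^ 6 * w + z ^ 7 * w) * two_eq_zero)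

/-- `C₂ = z + z² + IJ`, of reduced norm `z+z²`. -/
def C₂ : Orderˣ := unitOfNrd ⟨z + z ^ 2, 0, 0, 1⟩ ((1 + z + z ^ 2) * w) (by
  simp only [nrd]
  linear_combination z_mul_w +
    (z ^ 2 * w + z ^ 3 * w * 2 + z ^ 4 * w * 2 + z ^ 5 * w * 2 + z ^ 6 * w) * two_eq_zero)

/-- `D = 1 + z + z² + IJ`, of reduced norm `1+z+z²`. -/
def D : Orderˣ := unitOfNrd ⟨1 + z + z ^ 2, 0, 0, 1⟩ (z * (1 + z) * w) (by
  simp only [nrd]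
  linear_combination z_mul_w +
    (z ^ 2 * w * 2 + z ^ 3 * w * 3 + z ^ 4 * w * 2 + z ^ 5 * w * 2 + z ^ 6 * w) * two_eq_zero)

/-- The image `b₁` of `B₁` in `G(R)`. -/
def b₁ : G := QuotientGroup.mk B₁

/-- The image `b₂` of `B₂` in `G(R)`. -/
def b₂ : G := QuotientGroup.mk B₂

/-- The image `c₁` of `C₁` in `G(R)`. -/
def c₁ : G := QuotientGroup.mk C₁

/-- The image `c₂` of `C₂` in `G(R)`. -/
def c₂ : G := QuotientGroup.mk C₂

/-- The image `d` of `D` in `G(R)`. -/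
def d : G := QuotientGroup.mk D

/-- The subgroup `Λ = ⟨b₁, b₂, c₁, c₂⟩` of `G(R)`. -/
def Lam : Subgroup G := Subgroup.closure {b₁, b₂, c₁, c₂}

/-! ### The presentation -/

/-- The five abstract generators. -/
inductive Gen : Type
  | b₁ | b₂ | c₁ | c₂ | d

/-- The elements of `G(R)` that the abstract generators stand for. -/
def Gen.toG : Gen → G
  | .b₁ => QuatLattice.b₁
  | .b₂ => QuatLattice.b₂
  | .c₁ => QuatLattice.c₁
  | .c₂ => QuatLattice.c₂
  | .d => QuatLattice.d

/-- The ten relators `c₁²`, `c₂²`, `d²`, `c₁c₂(c₂c₁)⁻¹`, `c₁d(dc₁)⁻¹`, `c₂d(dc₂)⁻¹`,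
`b₁b₂c₁b₂`, `b₁c₂b₁b₂⁻¹`, `db₁db₁`, `db₂db₂`. -/
def relators : Set (FreeGroup Gen) :=
  let b₁ := FreeGroup.of Gen.b₁
  let b₂ := FreeGroup.of Gen.b₂
  let c₁ := FreeGroup.of Gen.c₁
  let c₂ := FreeGroup.of Gen.c₂
  let d := FreeGroup.of Gen.d
  {c₁ ^ 2, c₂ ^ 2, d ^ 2,
    (c₁ * c₂) * (c₂ * c₁)⁻¹, (c₁ * d) * (d * c₁)⁻¹, (c₂ * d) * (d * c₂)⁻¹,
    b₁ * b₂ * c₁ * b₂, b₁ * c₂ * b₁ * b₂⁻¹, d * b₁ * d * b₁, d * b₂ * d * b₂}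

/-! ### The standard vertex of the product of the two Bruhat-Tits trees -/

/-- The local field `𝔽₂((X))`; its valuation ring is `𝔽₂[[X]]`. -/
abbrev LocalField : Type := LaurentSeries (ZMod 2)

/-- The uniformizer of `𝔽₂((X))`. -/
def unif : LocalField := algebraMap (PowerSeries (ZMod 2)) LocalField PowerSeries.X

theorem unif_sq_add_ne_zero : unif ^ 2 + unif ≠ 0 := by
  intro h
  have h' : algebraMap (PowerSeries (ZMod 2)) LocalField (PowerSeries.X ^ 2 + PowerSeries.X)
      = algebraMap (PowerSeries (ZMod 2)) LocalField 0 := by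
    simpa [unif] using h
  have h2 := congrArg (PowerSeries.coeff 1)
    (FaithfulSMul.algebraMap_injective (PowerSeries (ZMod 2)) LocalField h')
  simp [PowerSeries.coeff_X_pow] at h2

theorem one_add_unif_sq_add_pow_ne_zero : 1 + (unif ^ 2 + unif) ^ 3 ≠ 0 := by
  intro h
  have h' : algebraMap (PowerSeries (ZMod 2)) LocalField
      (1 + (PowerSeries.X ^ 2 + PowerSeries.X) ^ 3)
      = algebraMap (PowerSeries (ZMod 2)) LocalField 0 := by
    simpa [unif] using h
  have h2 := congrArg PowerSeries.constantCoeff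
    (FaithfulSMul.algebraMap_injective (PowerSeries (ZMod 2)) LocalField h')
  simp at h2

/-- The ring homomorphism `R → 𝔽₂((X))` with `z ↦ ζ`. -/
def specialize (ζ : LocalField) (h₀ : ζ ≠ 0) (h₁ : 1 + ζ ^ 3 ≠ 0) : CoeffRing →+* LocalField :=
  IsLocalization.Away.lift (X * (1 + X ^ 3) : (ZMod 2)[X])
    (g := (Polynomial.aeval ζ : (ZMod 2)[X] →ₐ[ZMod 2] LocalField).toRingHom)
    (by simpa using ⟨h₀, h₁⟩)

/-- The embedding `R → 𝔽₂((y))` determined by `y² + y = z`. -/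
def embY : CoeffRing →+* LocalField :=
  specialize (unif ^ 2 + unif) unif_sq_add_ne_zero one_add_unif_sq_add_pow_ne_zero

/-- The embedding `R → 𝔽₂((t))` determined by `t² + t = u`, where `u = z⁻¹`. -/
def embT : CoeffRing →+* LocalField :=
  specialize (unif ^ 2 + unif)⁻¹ (inv_ne_zero unif_sq_add_ne_zero) (by
    intro h
    apply one_add_unif_sq_add_pow_ne_zero
    have h2 : (unif ^ 2 + unif) ^ 3 * (1 + ((unif ^ 2 + unif)⁻¹) ^ 3) = 0 := by
      rw [h, mul_zero]
    rw [mul_add, ← mul_pow, mul_inv_cancel₀ unif_sq_add_ne_zero, one_pow, mul_one] at h2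
    rwa [add_comm])

/-- The matrix `φ(x₀) + φ(x₁) I + φ(x₂) J + φ(x₃) I J` of the quaternion
`x₀ + x₁ I + x₂ J + x₃ IJ`, for given matrices `I` and `J`. -/
def matrixOf (φ : CoeffRing →+* LocalField) (I J : Matrix (Fin 2) (Fin 2) LocalField)
    (x : Order) : Matrix (Fin 2) (Fin 2) LocalField :=
  φ x.re • 1 + φ x.imI • I + φ x.imJ • J + φ x.imK • (I * J)

/-- The splitting `ρ_y` of `𝔒` over `𝔽₂((y))`. -/
def rhoY : Order → Matrix (Fin 2) (Fin 2) LocalField :=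
  let y := unif
  let z := y ^ 2 + y
  matrixOf embY !![y, 0; 0, 1 + y] !![0, 1 + z ^ 3; 1, 0]

/-- The splitting `ρ_t` of `𝔒` over `𝔽₂((t))`. -/
def rhoT : Order → Matrix (Fin 2) (Fin 2) LocalField :=
  let t := unif
  let u := t ^ 2 + t
  matrixOf embT !![1 + u + t, 1 + u ^ 3; u⁻¹, u + t] !![0, u⁻¹ + u ^ 2; (u ^ 2)⁻¹, 0]

/-- The standard lattice `𝔽₂[[X]]²` in `𝔽₂((X))²`. -/
def stdLattice : Submodule (PowerSeries (ZMod 2)) (Fin 2 → LocalField) :=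
  Submodule.span _ (Set.range (Pi.basisFun LocalField (Fin 2)))

/-- The image of a lattice under a matrix. -/
def latticeMap (M : Matrix (Fin 2) (Fin 2) LocalField)
    (L : Submodule (PowerSeries (ZMod 2)) (Fin 2 → LocalField)) :
    Submodule (PowerSeries (ZMod 2)) (Fin 2 → LocalField) :=
  L.map (M.mulVecLin.restrictScalars (PowerSeries (ZMod 2)))

/-- Two lattices are homothetic, that is, they define the same vertex of the Bruhat-Tits
tree of `PGL₂(𝔽₂((X)))`. -/
def Homothetic (L L' : Submodule (PowerSeries (ZMod 2)) (Fin 2 → LocalField)) : Prop :=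
  ∃ c : LocalField, c ≠ 0 ∧ L' = latticeMap (Matrix.scalar (Fin 2) c) L

/-- The unit `x` of `𝔒` fixes the vertex of the product of the trees of `PGL₂(𝔽₂((y)))` and
`PGL₂(𝔽₂((t)))` given by the pair of standard lattices. -/
def FixesStdVertex (x : Orderˣ) : Prop :=
  Homothetic stdLattice (latticeMap (rhoY x) stdLattice) ∧
    Homothetic stdLattice (latticeMap (rhoT x) stdLattice)

end QuatLattice

end

noncomputable section

namespace QuatLattice

section Splittings

open Polynomial

/-! ### The splittings as ring homomorphisms -/

/-! Both trees are trivalent. In the first, `b₁`, `c₁`, `d` fix the standard vertex, while `b₂`,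
`b₂⁻¹`, `c₂` move it along its three edges; in the second, `d` fixes the standard vertex and `b₁`,
`b₁⁻¹`, `c₁` move it along the three edges. No tree is constructed: vertices and edges are read off
from integral matrices and their residues over `𝔽₂`.

Injectivity of the map from the presented group: the relations rewrite every element as `δαβ` with
`δ ∈ {1, d}`, `α ∈ ⟨b₁, c₁⟩`, `β ∈ ⟨b₂, c₂⟩` (`exists_eq_mul_mul`). A nonempty reduced word in `b₂,
c₂` moves the vertex of the first tree, and one in `b₁, c₁` moves that of the second
(`Reduced.exists_hasRep`). Hence `δαβ ↦ 1` forces `β = 1`, then `α = 1`, then `δ = 1`.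

Surjectivity: `Λ` carries every vertex in the orbit of the standard vertex back to it
(`exists_mul_mem_fixers`), so only the stabilizer has to be found. An element of it lifts to a
quaternion `p` over `𝔽₂[z]` whose norm divides a power of `z(1+z³)`. If `z` divides the norm,
integrality at `z = 0` makes `p` divisible by `z`; if the square of `1+z` or `1+z+z²` divides it,
anisotropy of the norm form modulo that prime makes `p` divisible by the prime. After removing such
factors the norm has degree at most `3`, and integrality at infinity makes the degree even and
bounds the coordinates. A finite check leaves constants and `D` (`eq_smul_of_isVertexMatrix`).

So `G(R) = Λ⟨d⟩`. Conjugation by `d` preserves `Λ`, and the presentation supplies a character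
separating `d` from `Λ`. -/

instance : Nontrivial CoeffRing := embY.domain_nontrivial

instance : CharP CoeffRing 2 := CharTwo.of_one_ne_zero_of_two_eq_zero one_ne_zero two_eq_zero

theorem two_eq_zero_localField : (2 : LocalField) = 0 := by
  rw [← map_ofNat embY 2, two_eq_zero, map_zero]

instance : CharP LocalField 2 :=
  CharTwo.of_one_ne_zero_of_two_eq_zero one_ne_zero two_eq_zero_localField

theorem specialize_algebraMap (ζ : LocalField) (h₀ : ζ ≠ 0) (h₁ : 1 + ζ ^ 3 ≠ 0)
    (p : (ZMod 2)[X]) :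
    specialize ζ h₀ h₁ (algebraMap _ CoeffRing p) = Polynomial.aeval ζ p := by
  simp [specialize]

theorem specialize_z (ζ : LocalField) (h₀ : ζ ≠ 0) (h₁ : 1 + ζ ^ 3 ≠ 0) :
    specialize ζ h₀ h₁ z = ζ := by
  simp [z, specialize_algebraMap]

@[simp] theorem embY_z : embY z = unif ^ 2 + unif := specialize_z _ _ _

@[simp] theorem embT_z : embT z = (unif ^ 2 + unif)⁻¹ := specialize_z _ _ _

/-- Matrices satisfying the relations of `I` and `J` induce a ring homomorphism on `𝔒`. -/
theorem exists_ringHom_eq_matrixOf (φ : CoeffRing →+* LocalField)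
    {I J : Matrix (Fin 2) (Fin 2) LocalField} (hI : I * I = φ z • 1 + I)
    (hJ : J * J = (1 + φ z ^ 3) • (1 : Matrix (Fin 2) (Fin 2) LocalField))
    (hJI : J * I = J - I * J) :
    ∃ f : Order →+* Matrix (Fin 2) (Fin 2) LocalField, ∀ x, f x = matrixOf φ I J x := by
  let _ := φ.toAlgebra
  have hs : ∀ (r : CoeffRing) (M : Matrix (Fin 2) (Fin 2) LocalField), r • M = φ r • M := by
    intro r M; ext i j; simp [Algebra.smul_def]; rfl
  -- With the matrices viewed as an algebra through `φ`, the universal property of the quaternion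
  -- algebra applies.
  let q : QuaternionAlgebra.Basis (Matrix (Fin 2) (Fin 2) LocalField) z 1 (1 + z ^ 3) :=
    { i := I, j := J, k := I * J
      i_mul_i := by rw [hI, hs, one_smul]
      j_mul_j := by rw [hJ, hs]; simp
      i_mul_j := rfl
      j_mul_i := by rw [hJI, one_smul] }
  refine ⟨q.liftHom.toRingHom, fun x => ?_⟩
  show q.lift x = _
  simp only [QuaternionAlgebra.Basis.lift, matrixOf, Algebra.algebraMap_eq_smul_one, hs]
  rfl

theorem exists_ringHom_eq_rhoY :
    ∃ f : Order →+* Matrix (Fin 2) (Fin 2) LocalField, ∀ x, f x = rhoY x := by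
  apply exists_ringHom_eq_matrixOf
  all_goals
    rw [← Matrix.ext_iff]; intro i j; fin_cases i <;> fin_cases j <;>
    simp [Matrix.mul_apply, Fin.sum_univ_two] <;> grind

theorem exists_ringHom_eq_rhoT :
    ∃ f : Order →+* Matrix (Fin 2) (Fin 2) LocalField, ∀ x, f x = rhoT x := by
  have h := unif_sq_add_ne_zero
  apply exists_ringHom_eq_matrixOf
  all_goals
    rw [← Matrix.ext_iff]; intro i j; fin_cases i <;> fin_cases j <;>
    simp [Matrix.mul_apply, Fin.sum_univ_two] <;> grind

/-- `rhoY` as a ring homomorphism. -/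
def rhoYHom : Order →+* Matrix (Fin 2) (Fin 2) LocalField := exists_ringHom_eq_rhoY.choose

@[simp] theorem rhoYHom_apply (x : Order) : rhoYHom x = rhoY x :=
  exists_ringHom_eq_rhoY.choose_spec x

/-- `rhoT` as a ring homomorphism. -/
def rhoTHom : Order →+* Matrix (Fin 2) (Fin 2) LocalField := exists_ringHom_eq_rhoT.choose

@[simp] theorem rhoTHom_apply (x : Order) : rhoTHom x = rhoT x :=
  exists_ringHom_eq_rhoT.choose_spec x

theorem det_rhoY (x : Order) : (rhoY x).det = embY (nrd x) := by
  simp [rhoY, matrixOf, nrd, Matrix.det_fin_two]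
  grind

theorem det_rhoT (x : Order) : (rhoT x).det = embT (nrd x) := by
  have h := unif_sq_add_ne_zero
  simp only [rhoT, matrixOf, nrd, Matrix.det_fin_two]
  simp
  generalize embT x.re = a
  generalize embT x.imI = b
  generalize embT x.imJ = c
  generalize embT x.imK = d
  -- Naming the inverse leaves a polynomial identity modulo `w(t² + t) = 1` in characteristic two.
  obtain ⟨w, hw⟩ : ∃ w, w = (unif ^ 2 + unif)⁻¹ := ⟨_, rfl⟩
  have hw' : w * (unif ^ 2 + unif) = 1 := by rw [hw, inv_mul_cancel₀ h]
  simp only [← inv_pow, ← hw]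
  clear hw h
  generalize unif = t at *
  grind

theorem rhoY_algebraMap (a : CoeffRing) : rhoY (algebraMap CoeffRing Order a) = embY a • 1 := by
  simp [rhoY, matrixOf, QuaternionAlgebra.algebraMap_eq]

theorem rhoT_algebraMap (a : CoeffRing) : rhoT (algebraMap CoeffRing Order a) = embT a • 1 := by
  simp [rhoT, matrixOf, QuaternionAlgebra.algebraMap_eq]

end Splittings

/-! ### The relations -/

theorem nrd_mul {A : Type} [CommRing A] {ζ : A} (x y : Quat A ζ) :
    nrd (x * y) = nrd x * nrd y := by
  simp [nrd]
  ring

theorem nrd_smul {A : Type} [CommRing A] {ζ : A} (r : A) (x : Quat A ζ) :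
    nrd (r • x) = r ^ 2 * nrd x := by
  simp [nrd]
  ring

theorem nrd_one {A : Type} [CommRing A] {ζ : A} : nrd (1 : Quat A ζ) = 1 := by
  simp [nrd]

theorem isUnit_nrd {A : Type} [CommRing A] {ζ : A} (x : (Quat A ζ)ˣ) :
    IsUnit (nrd (x : Quat A ζ)) :=
  .of_mul_eq_one (nrd (x⁻¹ : (Quat A ζ)ˣ).val) (by rw [← nrd_mul, x.mul_inv, nrd_one])

/-- Units of `𝔒` that agree up to a scalar factor have the same class. -/
theorem mk_eq_mk_of_smul {x y : Orderˣ} (r : CoeffRing) (h : (x : Order) = r • (y : Order)) :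
    (QuotientGroup.mk x : G) = QuotientGroup.mk y := by
  -- Norms give `nrd x = r² nrd y`; the left side is a unit, hence so is `r`.
  have hr : IsUnit r := by
    have h1 := isUnit_nrd x
    rw [h, nrd_smul, IsUnit.mul_iff, isUnit_pow_iff two_ne_zero] at h1
    exact h1.1
  obtain ⟨r, rfl⟩ := hr
  refine (QuotientGroup.eq.2 (MonoidHom.mem_range.2 ⟨r, ?_⟩)).symm
  rw [eq_inv_mul_iff_mul_eq]
  ext1
  rw [Units.val_mul]
  rw [h, Algebra.smul_def]
  exact (Algebra.commutes (r : CoeffRing) (y : Order)).symm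

theorem exists_smul_of_mk_eq_mk {x y : Orderˣ}
    (h : (QuotientGroup.mk x : G) = QuotientGroup.mk y) :
    ∃ r : CoeffRingˣ, (x : Order) = (r : CoeffRing) • (y : Order) := by
  obtain ⟨r, hr⟩ := QuotientGroup.eq.1 h.symm
  refine ⟨r, ?_⟩
  rw [eq_inv_mul_iff_mul_eq] at hr
  rw [← hr, Algebra.smul_def]
  exact (Algebra.commutes (r : CoeffRing) (y : Order)).symm

/-- In this and the following relations the scalar is dictated by norms: its square is the quotient
of the reduced norms of the two sides, and square roots in `R` are unique. -/
theorem c₁_sq : c₁ ^ 2 = 1 := by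
  refine mk_eq_mk_of_smul (x := C₁ ^ 2) (y := 1) (1 + z) ?_
  ext <;> simp [C₁, unitOfNrd, pow_two] <;> grind

theorem c₂_sq : c₂ ^ 2 = 1 := by
  refine mk_eq_mk_of_smul (x := C₂ ^ 2) (y := 1) (z + z ^ 2) ?_
  ext <;> simp [C₂, unitOfNrd, pow_two] <;> grind

theorem d_sq : d ^ 2 = 1 := by
  refine mk_eq_mk_of_smul (x := D ^ 2) (y := 1) (1 + z + z ^ 2) ?_
  ext <;> simp [D, unitOfNrd, pow_two] <;> grind

theorem c₁_mul_c₂ : c₁ * c₂ = c₂ * c₁ := by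
  refine mk_eq_mk_of_smul (x := C₁ * C₂) (y := C₂ * C₁) 1 ?_
  ext <;> simp [C₁, C₂, unitOfNrd] <;> grind

theorem c₁_mul_d : c₁ * d = d * c₁ := by
  refine mk_eq_mk_of_smul (x := C₁ * D) (y := D * C₁) 1 ?_
  ext <;> simp [C₁, D, unitOfNrd] <;> grind

theorem c₂_mul_d : c₂ * d = d * c₂ := by
  refine mk_eq_mk_of_smul (x := C₂ * D) (y := D * C₂) 1 ?_
  ext <;> simp [C₂, D, unitOfNrd] <;> grind

theorem b₁_b₂_c₁_b₂ : b₁ * b₂ * c₁ * b₂ = 1 := by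
  refine mk_eq_mk_of_smul (x := B₁ * B₂ * C₁ * B₂) (y := 1) ((1 + z) * (z + z ^ 2)) ?_
  ext <;> simp [B₁, B₂, C₁, unitOfNrd] <;> grind

theorem b₁_c₂_b₁ : b₁ * c₂ * b₁ = b₂ := by
  refine mk_eq_mk_of_smul (x := B₁ * C₂ * B₁) (y := B₂) (1 + z) ?_
  ext <;> simp [B₁, B₂, C₂, unitOfNrd] <;> grind

theorem d_b₁_d_b₁ : d * b₁ * d * b₁ = 1 := by
  refine mk_eq_mk_of_smul (x := D * B₁ * D * B₁) (y := 1) ((1 + z + z ^ 2) * (1 + z)) ?_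
  ext <;> simp [D, B₁, unitOfNrd] <;> grind

theorem d_b₂_d_b₂ : d * b₂ * d * b₂ = 1 := by
  refine mk_eq_mk_of_smul (x := D * B₂ * D * B₂) (y := 1) ((1 + z + z ^ 2) * (z + z ^ 2)) ?_
  ext <;> simp [D, B₂, unitOfNrd] <;> grind

theorem lift_relators : ∀ r ∈ relators, FreeGroup.lift Gen.toG r = 1 := by
  simp only [relators, Set.mem_insert_iff, Set.mem_singleton_iff]
  rintro r (rfl | rfl | rfl | rfl | rfl | rfl | rfl | rfl | rfl | rfl) <;>
    simp only [map_pow, map_mul, map_inv, FreeGroup.lift_apply_of, Gen.toG]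
  · exact c₁_sq
  · exact c₂_sq
  · exact d_sq
  · rw [mul_inv_eq_one, c₁_mul_c₂]
  · rw [mul_inv_eq_one, c₁_mul_d]
  · rw [mul_inv_eq_one, c₂_mul_d]
  · exact b₁_b₂_c₁_b₂
  · rw [mul_inv_eq_one, b₁_c₂_b₁]
  · exact d_b₁_d_b₁
  · exact d_b₂_d_b₂

/-- The homomorphism from the presented group to `G(R)`. -/
def presentedToG : PresentedGroup relators →* G := PresentedGroup.toGroup lift_relators

@[simp] theorem presentedToG_of (s : Gen) : presentedToG (PresentedGroup.of s) = s.toG :=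
  PresentedGroup.toGroup.of lift_relators

/-! ### Integral representatives of local splittings -/

section Local

/-- The ring homomorphism `ρ` maps scalars to scalars. -/
def PreservesScalars (ρ : Order →+* Matrix (Fin 2) (Fin 2) LocalField) : Prop :=
  ∃ φ : CoeffRing →+* LocalField, ∀ a, ρ (algebraMap CoeffRing Order a) = φ a • 1

theorem preservesScalars_rhoY : PreservesScalars rhoYHom :=
  ⟨embY, fun a => by rw [rhoYHom_apply, rhoY_algebraMap]⟩

theorem preservesScalars_rhoT : PreservesScalars rhoTHom :=
  ⟨embT, fun a => by rw [rhoTHom_apply, rhoT_algebraMap]⟩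

/-- A matrix over `𝔽₂[[X]]`, viewed over `𝔽₂((X))`. -/
abbrev toLocal : Matrix (Fin 2) (Fin 2) (PowerSeries (ZMod 2)) →+*
    Matrix (Fin 2) (Fin 2) LocalField :=
  (algebraMap (PowerSeries (ZMod 2)) LocalField).mapMatrix

/-- The reduction of a matrix over `𝔽₂[[X]]` modulo `X`. -/
abbrev residue : Matrix (Fin 2) (Fin 2) (PowerSeries (ZMod 2)) →+*
    Matrix (Fin 2) (Fin 2) (ZMod 2) :=
  (PowerSeries.constantCoeff (R := ZMod 2)).mapMatrix

theorem algebraMap_localField_injective :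
    Function.Injective (algebraMap (PowerSeries (ZMod 2)) LocalField) :=
  FaithfulSMul.algebraMap_injective _ _

/-- The integral matrix `N` represents the image of `γ` in `PGL₂(𝔽₂((X)))`. -/
def HasRep (ρ : Order →+* Matrix (Fin 2) (Fin 2) LocalField) (γ : G)
    (N : Matrix (Fin 2) (Fin 2) (PowerSeries (ZMod 2))) : Prop :=
  ∃ x : Orderˣ, QuotientGroup.mk x = γ ∧ ∃ c : LocalField, c ≠ 0 ∧ ρ x = c • toLocal N

variable {ρ : Order →+* Matrix (Fin 2) (Fin 2) LocalField} {γ γ' : G}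
  {N N' : Matrix (Fin 2) (Fin 2) (PowerSeries (ZMod 2))}

/-- Two lifts of a class differ by a unit of `R`, which `ρ` turns into a nonzero scalar; the choice
of lift is therefore immaterial. -/
theorem hasRep_mk_iff (hρ : PreservesScalars ρ) {x : Orderˣ} :
    HasRep ρ (QuotientGroup.mk x) N ↔ ∃ c : LocalField, c ≠ 0 ∧ ρ x = c • toLocal N := by
  refine ⟨?_, fun h => ⟨x, rfl, h⟩⟩
  rintro ⟨y, hy, c, hc, h⟩
  obtain ⟨r, hr⟩ := exists_smul_of_mk_eq_mk hy.symm
  obtain ⟨φ, hφ⟩ := hρ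
  refine ⟨φ r * c, mul_ne_zero (r.isUnit.map φ).ne_zero hc, ?_⟩
  rw [hr, Algebra.smul_def, map_mul, hφ, h, smul_one_mul, smul_smul]

theorem HasRep.one : HasRep ρ 1 1 := ⟨1, rfl, 1, one_ne_zero, by simp⟩

theorem HasRep.mul (h : HasRep ρ γ N) (h' : HasRep ρ γ' N') : HasRep ρ (γ * γ') (N * N') := by
  obtain ⟨x, rfl, c, hc, hx⟩ := h
  obtain ⟨y, rfl, c', hc', hy⟩ := h'
  refine ⟨x * y, rfl, c * c', mul_ne_zero hc hc', ?_⟩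
  rw [Units.val_mul, map_mul, hx, hy, map_mul, smul_mul_smul_comm]

theorem HasRep.det_ne_zero (h : HasRep ρ γ N) : N.det ≠ 0 := by
  obtain ⟨x, rfl, c, hc, hx⟩ := h
  intro h0
  have h1 : IsUnit (ρ x).det := ((x.isUnit.map ρ).map Matrix.detMonoidHom)
  rw [hx, Matrix.det_smul, ← RingHom.map_det, h0] at h1
  simp at h1

/-- The adjugate is the inverse up to the scalar `det N`, and it remains integral. -/
theorem HasRep.inv (h : HasRep ρ γ N) : HasRep ρ γ⁻¹ N.adjugate := by
  have h0 := h.det_ne_zero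
  obtain ⟨x, rfl, c, hc, hx⟩ := h
  have h0' : algebraMap _ LocalField N.det ≠ 0 :=
    (map_ne_zero_iff _ algebraMap_localField_injective).2 h0
  have h2 : toLocal (N.det • 1) = algebraMap _ LocalField N.det • 1 := by
    ext1 i j
    by_cases hij : i = j <;> simp [hij]
  generalize algebraMap _ LocalField N.det = e at h0' h2
  refine ⟨x⁻¹, rfl, (c * e)⁻¹, inv_ne_zero (mul_ne_zero hc h0'), ?_⟩
  have h1 : ρ (x⁻¹ : Orderˣ) * ρ x = 1 := by rw [← map_mul, x.inv_mul, map_one]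
  refine left_inv_eq_right_inv h1 ?_
  rw [hx, smul_mul_smul_comm, ← map_mul, Matrix.mul_adjugate, h2, smul_smul, mul_right_comm,
    mul_inv_cancel₀ (mul_ne_zero hc h0'), one_smul]

theorem HasRep.of_smul {s : PowerSeries (ZMod 2)} (h : HasRep ρ γ (s • N)) : HasRep ρ γ N := by
  have h0 := h.det_ne_zero
  obtain ⟨x, rfl, c, hc, hx⟩ := h
  have hs : s ≠ 0 := by rintro rfl; simp [Matrix.det_zero] at h0
  refine ⟨x, rfl, c * algebraMap _ LocalField s,
    mul_ne_zero hc ((map_ne_zero_iff _ algebraMap_localField_injective).2 hs), ?_⟩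
  rw [hx, mul_smul]
  congr 1
  ext i j; simp

theorem det_residue (N : Matrix (Fin 2) (Fin 2) (PowerSeries (ZMod 2))) :
    (residue N).det = PowerSeries.constantCoeff N.det := by
  rw [RingHom.map_det]

theorem isUnit_det_iff : IsUnit N.det ↔ (residue N).det ≠ 0 := by
  rw [det_residue, PowerSeries.isUnit_iff_constantCoeff, isUnit_iff_ne_zero]

/-- A matrix representing the identity is a scalar matrix. -/
theorem HasRep.residue_of_one (hρ : PreservesScalars ρ) (h : HasRep ρ 1 N)
    (h0 : residue N ≠ 0) : (residue N).det ≠ 0 := by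
  obtain ⟨c, hc, h⟩ := (hasRep_mk_iff hρ (x := 1)).1 h
  rw [Units.val_one, map_one] at h
  have e : ∀ i j, (1 : Matrix (Fin 2) (Fin 2) LocalField) i j = c * algebraMap _ LocalField (N i j) := by
    intro i j; rw [h]; simp
  have h01 : N 0 1 = 0 := by
    have := e 0 1
    simpa [hc, -LaurentSeries.coe_algebraMap] using this
  have h10 : N 1 0 = 0 := by
    have := e 1 0
    simpa [hc, -LaurentSeries.coe_algebraMap] using this
  have h11 : N 0 0 = N 1 1 := by
    have := (e 0 0).symm.trans (Eq.trans (by simp) (e 1 1))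
    exact algebraMap_localField_injective (mul_left_cancel₀ hc this)
  intro hd
  apply h0
  rw [Matrix.det_fin_two] at hd
  ext i j
  fin_cases i <;> fin_cases j <;> simp_all

variable (ρ) in
/-- The stabilizer in `G(R)` of the standard vertex of one tree. -/
def fixer : Subgroup G where
  carrier := {γ | ∃ N, IsUnit N.det ∧ HasRep ρ γ N}
  one_mem' := ⟨1, by simp, .one⟩
  mul_mem' := by
    rintro _ _ ⟨N, hN, h⟩ ⟨N', hN', h'⟩
    exact ⟨N * N', by rw [Matrix.det_mul]; exact hN.mul hN', h.mul h'⟩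
  inv_mem' := by
    rintro _ ⟨N, hN, h⟩
    exact ⟨N.adjugate, by rw [Matrix.det_adjugate]; exact hN.pow _, h.inv⟩

/-- The exponent `n` bounds the distance from the standard vertex to its image; it is the induction
measure in `exists_mul_mem_fixer`. -/
theorem exists_hasRep (ρ : Order →+* Matrix (Fin 2) (Fin 2) LocalField) (γ : G) :
    ∃ N, HasRep ρ γ N ∧ ∃ n : ℕ, N.det ∣ PowerSeries.X ^ n := by
  obtain ⟨x, rfl⟩ := QuotientGroup.mk_surjective γ
  obtain ⟨s, hs⟩ := IsLocalization.exist_integer_multiples_of_finite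
    (nonZeroDivisors (PowerSeries (ZMod 2))) (fun p : Fin 2 × Fin 2 => ρ x p.1 p.2)
  choose N hN using hs
  have hs0 : algebraMap _ LocalField (s : PowerSeries (ZMod 2)) ≠ 0 :=
    (map_ne_zero_iff _ algebraMap_localField_injective).2 (nonZeroDivisors.ne_zero s.2)
  have h : HasRep ρ (QuotientGroup.mk x) (Matrix.of fun i j => N (i, j)) := by
    refine ⟨x, rfl, _, inv_ne_zero hs0, ?_⟩
    ext i j
    have := hN (i, j)
    simp only [Algebra.smul_def] at this
    simp only [Matrix.smul_apply, RingHom.mapMatrix_apply, Matrix.map_apply, Matrix.of_apply,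
      this, smul_eq_mul]
    rw [inv_mul_cancel_left₀ hs0]
  refine ⟨_, h, ?_⟩
  generalize Matrix.of (fun i j => N (i, j)) = N at h
  have hd := h.det_ne_zero
  obtain ⟨n, hn⟩ := IsDiscreteValuationRing.associated_pow_irreducible hd
    (PowerSeries.X_irreducible (R := ZMod 2))
  exact ⟨n, hn.dvd⟩

end Local

section Trees

/-! ### Reduced words -/

/-- The three letters `b`, `b⁻¹`, `c`, where `c` is an involution. -/
inductive Letter : Type
  | pos | neg | invol

namespace Letter

/-- The inverse letter. -/
def inv : Letter → Letter
  | pos => neg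
  | neg => pos
  | invol => invol

/-- The group element that a letter stands for. -/
def eval {H : Type*} [Group H] (b c : H) : Letter → H
  | pos => b
  | neg => b⁻¹
  | invol => c

/-- The matrix that a letter stands for. -/
def mat {A : Type*} [CommRing A] (B C : Matrix (Fin 2) (Fin 2) A) :
    Letter → Matrix (Fin 2) (Fin 2) A
  | pos => B
  | neg => B.adjugate
  | invol => C

theorem eval_inv {H : Type*} [Group H] {b c : H} (hc : c ^ 2 = 1) (s : Letter) :
    eval b c s.inv = (eval b c s)⁻¹ := by
  cases s <;> simp [eval, inv]
  rw [eq_inv_iff_mul_eq_one, ← pow_two, hc]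

theorem eval_mem {H : Type*} [Group H] (b c : H) (s : Letter) :
    eval b c s ∈ Subgroup.closure {b, c} := by
  cases s
  · exact Subgroup.subset_closure (by simp [eval])
  · exact inv_mem (Subgroup.subset_closure (by simp))
  · exact Subgroup.subset_closure (by simp [eval])

theorem map_eval {H H' : Type*} [Group H] [Group H'] (f : H →* H') (b c : H) (s : Letter) :
    f (eval b c s) = eval (f b) (f c) s := by
  cases s <;> simp [eval]

end Letter

open Letter

/-- `Reduced b c s γ` says that `γ` is the product of a nonempty reduced word with first
letter `s`. -/
inductive Reduced {H : Type*} [Group H] (b c : H) : Letter → H → Prop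
  | single (s : Letter) : Reduced b c s (s.eval b c)
  | cons (s t : Letter) (γ : H) : Reduced b c t γ → t ≠ s.inv → Reduced b c s (s.eval b c * γ)

theorem Reduced.letter_mul {H : Type*} [Group H] {b c : H} (hc : c ^ 2 = 1) {γ : H}
    (h : γ = 1 ∨ ∃ s, Reduced b c s γ) (r : Letter) :
    r.eval b c * γ = 1 ∨ ∃ s, Reduced b c s (r.eval b c * γ) := by
  rcases h with rfl | ⟨s, h⟩
  · exact .inr ⟨r, by rw [mul_one]; exact .single r⟩
  by_cases hs : s = r.inv
  · subst hs
    cases h with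
    | single => left; rw [eval_inv hc, mul_inv_cancel]
    | cons _ t γ h =>
      rw [eval_inv hc, mul_inv_cancel_left]
      exact .inr ⟨t, h⟩
  · exact .inr ⟨r, .cons r s γ h hs⟩

theorem eq_one_or_reduced {H : Type*} [Group H] {b c : H} (hc : c ^ 2 = 1) {γ : H}
    (h : γ ∈ Subgroup.closure {b, c}) : γ = 1 ∨ ∃ s, Reduced b c s γ := by
  induction h using Subgroup.closure_induction_left with
  | one => exact .inl rfl
  | mul_left x hx y hy ih =>
    rcases hx with rfl | rfl
    · exact Reduced.letter_mul hc ih .pos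
    · exact Reduced.letter_mul hc ih .invol
  | inv_mul_cancel x hx y hy ih =>
    rcases hx with rfl | rfl
    · exact Reduced.letter_mul hc ih .neg
    · have := Reduced.letter_mul hc ih (.inv .invol)
      rwa [eval_inv hc] at this

/-! ### Moving the standard vertex of one tree -/

/-- The residue matrices `B` and `C` of `b` and `c` belong to two of the three edges at the
standard vertex, the third one belonging to `b⁻¹`. -/
structure IsEdgePair (B C : Matrix (Fin 2) (Fin 2) (ZMod 2)) : Prop where
  -- The kernels of the three letters are the three lines of `𝔽₂²`. The image of a letter lies in
  -- the kernel of its inverse, distinct letters have distinct kernels, and every singular matrix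
  -- has its image in one of these kernels.
  ne_zero : ∀ s, mat B C s ≠ 0
  inv_mul : ∀ s, mat B C s.inv * mat B C s = 0
  mul_ne_zero : ∀ s t M, t ≠ s.inv → M ≠ 0 → mat B C t.inv * M = 0 → mat B C s * M ≠ 0
  exists_mul : ∀ M : Matrix (Fin 2) (Fin 2) (ZMod 2), M.det = 0 → ∃ s, mat B C s * M = 0

theorem isEdgePair_y : IsEdgePair !![0, 1; 0, 1] !![0, 0; 1, 0] where
  ne_zero s := by cases s <;> decide
  inv_mul s := by cases s <;> decide
  mul_ne_zero s t := by
    -- The pairs with `t = s.inv` are vacuous; for each other pair all sixteen matrices `M` are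
    -- checked.
    cases s <;> cases t <;> first | exact fun _ h => absurd rfl h | skip
    all_goals
      intro M _
      revert M
      decide
  exists_mul M hM := by
    have h : ∀ M : Matrix (Fin 2) (Fin 2) (ZMod 2), M.det = 0 →
        mat !![0, 1; 0, 1] !![0, 0; 1, 0] pos * M = 0 ∨ mat !![0, 1; 0, 1] !![0, 0; 1, 0] neg * M = 0 ∨
        mat !![0, 1; 0, 1] !![0, 0; 1, 0] invol * M = 0 := by decide
    rcases h M hM with h | h | h
    exacts [⟨_, h⟩, ⟨_, h⟩, ⟨_, h⟩]

theorem isEdgePair_t : IsEdgePair !![1, 0; 1, 0] !![0, 1; 0, 0] where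
  ne_zero s := by cases s <;> decide
  inv_mul s := by cases s <;> decide
  mul_ne_zero s t := by
    cases s <;> cases t <;> first | exact fun _ h => absurd rfl h | skip
    all_goals
      intro M _
      revert M
      decide
  exists_mul M hM := by
    have h : ∀ M : Matrix (Fin 2) (Fin 2) (ZMod 2), M.det = 0 →
        mat !![1, 0; 1, 0] !![0, 1; 0, 0] pos * M = 0 ∨ mat !![1, 0; 1, 0] !![0, 1; 0, 0] neg * M = 0 ∨
        mat !![1, 0; 1, 0] !![0, 1; 0, 0] invol * M = 0 := by decide
    rcases h M hM with h | h | h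
    exacts [⟨_, h⟩, ⟨_, h⟩, ⟨_, h⟩]

variable {ρ : Order →+* Matrix (Fin 2) (Fin 2) LocalField} {b c : G}
  {B C : Matrix (Fin 2) (Fin 2) (PowerSeries (ZMod 2))}

theorem HasRep.letter (hb : HasRep ρ b B) (hc : HasRep ρ c C) (s : Letter) :
    HasRep ρ (s.eval b c) (s.mat B C) := by
  cases s
  · exact hb
  · exact hb.inv
  · exact hc

theorem residue_mat (s : Letter) :
    residue (s.mat B C) = s.mat (residue B) (residue C) := by
  cases s
  · rfl
  · exact RingHom.map_adjugate _ _
  · rfl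

/-- Ping-pong: the image of the residue lies in the kernel of the inverse of the first letter. A new
letter that does not cancel has another kernel, so the residue stays nonzero. Words live in `H`
rather than `G` so that triviality can be concluded in the presented group. -/
theorem Reduced.exists_hasRep {H : Type*} [Group H] {f : H →* G} {b c : H}
    (hb : HasRep ρ (f b) B) (hc : HasRep ρ (f c) C)
    (hE : IsEdgePair (residue B) (residue C)) {s : Letter} {γ : H} (h : Reduced b c s γ) :
    ∃ N, HasRep ρ (f γ) N ∧ residue N ≠ 0 ∧ s.inv.mat (residue B) (residue C) * residue N = 0 := by
  induction h with
  | single s =>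
    refine ⟨s.mat B C, ?_, ?_, ?_⟩
    · rw [map_eval]; exact HasRep.letter hb hc s
    · rw [residue_mat]; exact hE.ne_zero s
    · rw [residue_mat]; exact hE.inv_mul s
  | cons s t γ h hst ih =>
    obtain ⟨N, hN, h0, h1⟩ := ih
    refine ⟨s.mat B C * N, ?_, ?_, ?_⟩
    · rw [map_mul, map_eval]; exact (HasRep.letter hb hc s).mul hN
    · rw [map_mul, residue_mat]; exact hE.mul_ne_zero s t _ hst h0 h1
    · rw [map_mul, residue_mat, ← mul_assoc, hE.inv_mul, zero_mul]

/-- An element of `⟨b, c⟩` whose image fixes the standard vertex up to a stabilizing factor is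
trivial. -/
theorem eq_one_of_mul_eq_one {H : Type*} [Group H] {f : H →* G} {b c : H} (hc2 : c ^ 2 = 1)
    (hρ : PreservesScalars ρ) (hb : HasRep ρ (f b) B) (hc : HasRep ρ (f c) C)
    (hE : IsEdgePair (residue B) (residue C)) {γ : H} (hγ : γ ∈ Subgroup.closure {b, c})
    {g : G} (hg : g ∈ fixer ρ) (h : g * f γ = 1) : γ = 1 := by
  rcases eq_one_or_reduced hc2 hγ with rfl | ⟨s, hs⟩
  · rfl
  exfalso
  obtain ⟨N, hN, h0, h1⟩ := hs.exists_hasRep hb hc hE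
  obtain ⟨U, hU, hgU⟩ := hg
  have hm := hgU.mul hN
  rw [h] at hm
  have hU' := isUnit_det_iff.1 hU
  have hdN : (residue N).det = 0 := by
    by_contra hd
    have : IsUnit (residue N) := (Matrix.isUnit_iff_isUnit_det _).2 (isUnit_iff_ne_zero.2 hd)
    exact hE.ne_zero _ (this.mul_left_eq_zero.1 h1)
  -- The product `U * N` represents the identity, yet its residue is nonzero and singular.
  have hUu : IsUnit (residue U) := (Matrix.isUnit_iff_isUnit_det _).2 (isUnit_iff_ne_zero.2 hU')
  refine hm.residue_of_one hρ ?_ ?_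
  · rw [map_mul]
    exact fun h => h0 (hUu.mul_right_eq_zero.1 h)
  · rw [map_mul, Matrix.det_mul, hdN, mul_zero]

theorem exists_eq_smul_of_residue_eq_zero {N : Matrix (Fin 2) (Fin 2) (PowerSeries (ZMod 2))}
    (h : residue N = 0) : ∃ N', N = (PowerSeries.X : PowerSeries (ZMod 2)) • N' := by
  have : ∀ i j, ∃ a, N i j = PowerSeries.X * a := fun i j =>
    PowerSeries.X_dvd_iff.2 (congrFun (congrFun h i) j)
  choose N' hN' using this
  exact ⟨Matrix.of N', by ext1 i j; simp [hN']⟩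

/-- Elements of `⟨b, c⟩` bring any vertex of the tree to the standard vertex. -/
theorem exists_mul_mem_fixer (hb : HasRep ρ b B) (hc : HasRep ρ c C)
    (hE : IsEdgePair (residue B) (residue C)) (hB : B.det ∣ PowerSeries.X)
    (hC : C.det ∣ PowerSeries.X) (γ : G) :
    ∃ g ∈ Subgroup.closure {b, c}, g * γ ∈ fixer ρ := by
  obtain ⟨N, hN, n, hn⟩ := exists_hasRep ρ γ
  induction n using Nat.strong_induction_on generalizing γ N with
  | _ n ih =>
    have hX : (PowerSeries.X : PowerSeries (ZMod 2)) ≠ 0 := PowerSeries.X_ne_zero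
    by_cases hu : IsUnit N.det
    · exact ⟨1, one_mem _, N, hu, by rwa [one_mul]⟩
    have hd : (residue N).det = 0 := by
      by_contra h
      exact hu (isUnit_det_iff.2 h)
    have hn0 : n ≠ 0 := by
      rintro rfl
      exact hu (isUnit_of_dvd_one (by simpa using hn))
    obtain ⟨s, hs⟩ := hE.exists_mul _ hd
    have hsdet : (s.mat B C).det ∣ PowerSeries.X := by
      cases s
      · exact hB
      · simpa [mat, Matrix.det_adjugate] using hB
      · exact hC
    obtain ⟨N', hN'⟩ := exists_eq_smul_of_residue_eq_zero (N := s.mat B C * N)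
      (by rw [map_mul, residue_mat, hs])
    have h1 := (HasRep.letter hb hc s).mul hN
    rw [hN'] at h1
    -- The letter contributes at most one factor `X` to the determinant, and dividing all entries by
    -- `X` removes two.
    have h2 : N'.det ∣ PowerSeries.X ^ (n - 1) := by
      have h3 := mul_dvd_mul hsdet hn
      rw [← Matrix.det_mul, hN', Matrix.det_smul, Fintype.card_fin] at h3
      obtain ⟨k, rfl⟩ := Nat.exists_eq_succ_of_ne_zero hn0
      have h4 : PowerSeries.X ^ 2 * N'.det ∣ PowerSeries.X ^ 2 * PowerSeries.X ^ k := by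
        convert h3 using 1; rw [Nat.succ_eq_add_one]; ring
      simpa using (mul_dvd_mul_iff_left (pow_ne_zero 2 hX)).1 h4
    obtain ⟨g, hg, hgγ⟩ := ih (n - 1) (by omega) _ N' h1.of_smul h2
    exact ⟨g * s.eval b c, mul_mem hg (eval_mem b c s), by rwa [mul_assoc]⟩

end Trees

section Vertices

/-! ### The standard vertices -/

theorem mem_stdLattice {v : Fin 2 → LocalField} :
    v ∈ stdLattice ↔ ∀ i, v i ∈ Set.range (algebraMap (PowerSeries (ZMod 2)) LocalField) := by
  rw [stdLattice, Module.Basis.mem_span_iff_repr_mem]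
  simp only [Pi.basisFun_repr]

theorem mulVec_toLocal_mem {N : Matrix (Fin 2) (Fin 2) (PowerSeries (ZMod 2))}
    {v : Fin 2 → LocalField} (hv : v ∈ stdLattice) : (toLocal N).mulVec v ∈ stdLattice := by
  rw [mem_stdLattice] at hv ⊢
  choose a ha using hv
  intro i
  refine ⟨N.mulVec a i, ?_⟩
  simp only [Matrix.mulVec, dotProduct, map_sum, map_mul, RingHom.mapMatrix_apply,
    Matrix.map_apply, ha]

theorem mem_latticeMap {M : Matrix (Fin 2) (Fin 2) LocalField}
    {L : Submodule (PowerSeries (ZMod 2)) (Fin 2 → LocalField)} {v : Fin 2 → LocalField} :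
    v ∈ latticeMap M L ↔ ∃ x ∈ L, M.mulVec x = v := Iff.rfl

theorem mem_latticeMap_scalar {c : LocalField}
    {L : Submodule (PowerSeries (ZMod 2)) (Fin 2 → LocalField)} {v : Fin 2 → LocalField} :
    v ∈ latticeMap (Matrix.scalar (Fin 2) c) L ↔ ∃ x ∈ L, c • x = v := by
  simp only [mem_latticeMap, Matrix.scalar_apply, ← Matrix.smul_one_eq_diagonal,
    Matrix.smul_mulVec, Matrix.one_mulVec]

/-- A matrix maps the standard lattice to a homothetic one if and only if it is a scalar
multiple of an invertible integral matrix. -/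
theorem homothetic_stdLattice_iff {g : Matrix (Fin 2) (Fin 2) LocalField} :
    Homothetic stdLattice (latticeMap g stdLattice) ↔
      ∃ N, IsUnit N.det ∧ ∃ c : LocalField, c ≠ 0 ∧ g = c • toLocal N := by
  constructor
  · rintro ⟨c, hc, h⟩
    have hstd : ∀ j, (Pi.single j 1 : Fin 2 → LocalField) ∈ stdLattice := by
      intro j
      rw [mem_stdLattice]
      intro i
      rcases eq_or_ne i j with rfl | hij
      · exact ⟨1, by simp⟩
      · exact ⟨0, by simp [hij]⟩
    have h1 : ∀ i j, ∃ a, g i j = c * algebraMap (PowerSeries (ZMod 2)) LocalField a := by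
      intro i j
      have hj : g.mulVec (Pi.single j 1) ∈ latticeMap g stdLattice :=
        mem_latticeMap.2 ⟨_, hstd j, rfl⟩
      rw [h, mem_latticeMap_scalar] at hj
      obtain ⟨x, hx, hxj⟩ := hj
      obtain ⟨a, ha⟩ := mem_stdLattice.1 hx i
      refine ⟨a, ?_⟩
      have := congrFun hxj i
      rw [Matrix.mulVec_single_one] at this
      rw [ha]
      exact this.symm
    choose N hN using h1
    have hg : g = c • toLocal (Matrix.of N) := by
      ext1 i j
      exact hN i j
    refine ⟨Matrix.of N, ?_, c, hc, hg⟩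
    -- Equality of the lattices makes the standard basis vectors images of integral vectors; these
    -- are the columns of a right inverse of `N`.
    have h2 : ∀ j, ∃ v : Fin 2 → PowerSeries (ZMod 2),
        (Matrix.of N).mulVec v = Pi.single j 1 := by
      intro j
      have hj : c • Pi.single j 1 ∈ latticeMap g stdLattice := by
        rw [h]
        exact mem_latticeMap_scalar.2 ⟨_, hstd j, rfl⟩
      obtain ⟨x, hx, hxj⟩ := mem_latticeMap.1 hj
      rw [hg, Matrix.smul_mulVec] at hxj
      have hxj := smul_right_injective _ hc hxj
      choose a ha using mem_stdLattice.1 hx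
      refine ⟨a, ?_⟩
      ext1 i
      apply algebraMap_localField_injective
      have := congrFun hxj i
      simp only [Matrix.mulVec, dotProduct, RingHom.mapMatrix_apply, Matrix.map_apply, ← ha] at this
      simp only [Matrix.mulVec, dotProduct, map_sum, map_mul, this]
      rcases eq_or_ne i j with rfl | hij
      · simp
      · simp [hij]
    choose V hV using h2
    have h3 : Matrix.of N * (Matrix.of V).transpose = 1 := by
      ext1 i j
      refine (congrFun (hV j) i).trans ?_
      rw [Pi.single_apply, Matrix.one_apply]
    exact (Matrix.isUnit_iff_isUnit_det _).1 (IsUnit.of_mul_eq_one _ h3)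
  · rintro ⟨N, hN, c, hc, rfl⟩
    refine ⟨c, hc, ?_⟩
    ext v
    rw [mem_latticeMap, mem_latticeMap_scalar]
    constructor
    · rintro ⟨x, hx, rfl⟩
      exact ⟨_, mulVec_toLocal_mem hx, (Matrix.smul_mulVec ..).symm⟩
    · rintro ⟨x, hx, rfl⟩
      refine ⟨_, mulVec_toLocal_mem (N := N⁻¹) hx, ?_⟩
      rw [Matrix.smul_mulVec, Matrix.mulVec_mulVec, ← map_mul, Matrix.mul_nonsing_inv _ hN,
        map_one, Matrix.one_mulVec]

theorem mk_mem_fixer_iff {ρ : Order →+* Matrix (Fin 2) (Fin 2) LocalField}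
    (hρ : PreservesScalars ρ) {x : Orderˣ} :
    (QuotientGroup.mk x : G) ∈ fixer ρ ↔ Homothetic stdLattice (latticeMap (ρ x) stdLattice) := by
  rw [homothetic_stdLattice_iff]
  exact exists_congr fun N => and_congr_right fun _ => hasRep_mk_iff hρ

theorem fixesStdVertex_iff {x : Orderˣ} :
    FixesStdVertex x ↔ (QuotientGroup.mk x : G) ∈ fixer rhoYHom ⊓ fixer rhoTHom := by
  rw [Subgroup.mem_inf, mk_mem_fixer_iff preservesScalars_rhoY,
    mk_mem_fixer_iff preservesScalars_rhoT, FixesStdVertex, rhoYHom_apply, rhoTHom_apply]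

/-! ### Representatives of the generators -/

theorem rhoY_eq (x : Order) : rhoY x =
    !![embY x.re + embY x.imI * unif,
        (embY x.imJ + embY x.imK * unif) * (1 + (unif ^ 2 + unif) ^ 3);
      embY x.imJ + embY x.imK * (1 + unif), embY x.re + embY x.imI * (1 + unif)] := by
  ext1 i j
  fin_cases i <;> fin_cases j <;> simp [rhoY, matrixOf]
  ring

theorem rhoT_eq (x : Order) (w : LocalField) (hw : w * (unif ^ 2 + unif) = 1) : rhoT x =
    !![embT x.re + embT x.imI * (1 + unif ^ 2) + embT x.imK * (w ^ 2 + (unif ^ 2 + unif)),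
        embT x.imI * (1 + (unif ^ 2 + unif) ^ 3) + embT x.imJ * (w + (unif ^ 2 + unif) ^ 2)
          + embT x.imK * (1 + unif ^ 2) * (w + (unif ^ 2 + unif) ^ 2);
      embT x.imI * w + embT x.imJ * w ^ 2 + embT x.imK * unif ^ 2 * w ^ 2,
        embT x.re + embT x.imI * unif ^ 2 + embT x.imK * (w ^ 2 + (unif ^ 2 + unif))] := by
  have hw' : (unif ^ 2 + unif)⁻¹ = w := (eq_inv_of_mul_eq_one_left hw).symm
  ext1 i j
  fin_cases i <;> fin_cases j <;> simp [rhoT, matrixOf, ← inv_pow, hw'] <;> grind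

theorem exists_inv_unif_sq_add : ∃ w : LocalField, w * (unif ^ 2 + unif) = 1 :=
  ⟨_, inv_mul_cancel₀ unif_sq_add_ne_zero⟩

theorem algebraMap_X : algebraMap (PowerSeries (ZMod 2)) LocalField PowerSeries.X = unif := rfl

theorem unif_ne_zero : unif ≠ 0 := by
  intro h
  apply unif_sq_add_ne_zero
  rw [h]; ring

theorem one_add_unif_ne_zero : 1 + unif ≠ 0 := by
  intro h
  apply unif_sq_add_ne_zero
  linear_combination unif * h

theorem hasRep_y {x : Orderˣ} {N : Matrix (Fin 2) (Fin 2) (PowerSeries (ZMod 2))}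
    (h : rhoY x = toLocal N) : HasRep rhoYHom (QuotientGroup.mk x) N :=
  ⟨x, rfl, 1, one_ne_zero, by rw [rhoYHom_apply, h, one_smul]⟩

/-- For `b₁`, `c₁` and `d` the factor `t(1+t)²` clears all denominators: their entries have at most
a simple pole at `t = 0`, and the remaining powers of the unit `1+t` are cleared only for
convenience. -/
theorem hasRep_t {x : Orderˣ} {N : Matrix (Fin 2) (Fin 2) (PowerSeries (ZMod 2))}
    (h : (unif * (1 + unif) ^ 2) • rhoT x = toLocal N) :
    HasRep rhoTHom (QuotientGroup.mk x) N := by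
  have h0 : unif * (1 + unif) ^ 2 ≠ 0 :=
    mul_ne_zero unif_ne_zero (pow_ne_zero 2 one_add_unif_ne_zero)
  exact ⟨x, rfl, _, inv_ne_zero h0, by rw [rhoTHom_apply, ← h, inv_smul_smul₀ h0]⟩

theorem mem_fixer_of_hasRep {ρ : Order →+* Matrix (Fin 2) (Fin 2) LocalField} {γ : G}
    {N : Matrix (Fin 2) (Fin 2) (PowerSeries (ZMod 2))} (h : HasRep ρ γ N)
    (hN : PowerSeries.constantCoeff N.det = 1) : γ ∈ fixer ρ :=
  ⟨N, by rw [PowerSeries.isUnit_iff_constantCoeff, hN]; exact isUnit_one, h⟩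

theorem dvd_X_of_eq_mul {a e : PowerSeries (ZMod 2)} (h : a = PowerSeries.X * e)
    (he : PowerSeries.constantCoeff e = 1) : a ∣ PowerSeries.X := by
  have : IsUnit e := by rw [PowerSeries.isUnit_iff_constantCoeff, he]; exact isUnit_one
  rw [h]
  exact this.mul_right_dvd.2 dvd_rfl

instance : CharP (PowerSeries (ZMod 2)) 2 :=
  CharTwo.of_one_ne_zero_of_two_eq_zero one_ne_zero
    (algebraMap_localField_injective (by rw [map_ofNat, map_zero, two_eq_zero_localField]))

/-- The element `X² + X` of `𝔽₂[[X]]`. -/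
abbrev asX : PowerSeries (ZMod 2) := PowerSeries.X ^ 2 + PowerSeries.X

open PowerSeries (X)

/-- `b₁`, `c₁` and `d` are integral at `z = 0` with norms `1+z`, `1+z`, `1+z+z²`, which are units
there. -/
theorem b₁_mem_fixer_y : b₁ ∈ fixer rhoYHom := by
  refine mem_fixer_of_hasRep (N :=
    !![(1 + asX) * X, 1 + asX ^ 3;
      1, (1 + asX) * (1 + X)]) (hasRep_y ?_) (by simp [Matrix.det_fin_two])
  rw [rhoY_eq]
  ext1 i j
  fin_cases i <;> fin_cases j <;>
    simp [B₁, unitOfNrd, algebraMap_X, -LaurentSeries.coe_algebraMap]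

theorem c₁_mem_fixer_y : c₁ ∈ fixer rhoYHom := by
  refine mem_fixer_of_hasRep (N :=
    !![1 + asX ^ 2, X * (1 + asX ^ 3);
      1 + X, 1 + asX ^ 2]) (hasRep_y ?_) (by simp [Matrix.det_fin_two])
  rw [rhoY_eq]
  ext1 i j
  fin_cases i <;> fin_cases j <;>
    simp [C₁, unitOfNrd, algebraMap_X, -LaurentSeries.coe_algebraMap]

theorem d_mem_fixer_y : d ∈ fixer rhoYHom := by
  refine mem_fixer_of_hasRep (N :=
    !![1 + asX + asX ^ 2, X * (1 + asX ^ 3);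
      1 + X, 1 + asX + asX ^ 2]) (hasRep_y ?_) (by simp [Matrix.det_fin_two])
  rw [rhoY_eq]
  ext1 i j
  fin_cases i <;> fin_cases j <;>
    simp [D, unitOfNrd, algebraMap_X, -LaurentSeries.coe_algebraMap]

/-- The integral matrix representing `b₂`, which moves the standard vertex along an edge. -/
def edgeB₂ : Matrix (Fin 2) (Fin 2) (PowerSeries (ZMod 2)) :=
  !![asX + asX ^ 2 + (1 + asX) * X, (1 + X) * (1 + asX ^ 3);
      X, asX + asX ^ 2 + (1 + asX) * (1 + X)]

theorem hasRep_b₂ : HasRep rhoYHom b₂ edgeB₂ := by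
  refine hasRep_y ?_
  rw [edgeB₂]
  rw [rhoY_eq]
  ext1 i j
  fin_cases i <;> fin_cases j <;>
    simp [B₂, unitOfNrd, algebraMap_X, -LaurentSeries.coe_algebraMap] <;> grind

/-- The norm `z+z²` has a simple zero at `z = 0`, which makes the displacement a single edge. -/
theorem det_edgeB₂_dvd : edgeB₂.det ∣ X := by
  refine dvd_X_of_eq_mul (e := (1 + X) * (1 + asX)) ?_ (by simp)
  rw [edgeB₂, Matrix.det_fin_two_of]
  grind

/-- The integral matrix representing `c₂`, which moves the standard vertex along an edge. -/
def edgeC₂ : Matrix (Fin 2) (Fin 2) (PowerSeries (ZMod 2)) :=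
  !![asX + asX ^ 2, X * (1 + asX ^ 3);
      1 + X, asX + asX ^ 2]

theorem hasRep_c₂ : HasRep rhoYHom c₂ edgeC₂ := by
  refine hasRep_y ?_
  rw [edgeC₂]
  rw [rhoY_eq]
  ext1 i j
  fin_cases i <;> fin_cases j <;>
    simp [C₂, unitOfNrd, algebraMap_X, -LaurentSeries.coe_algebraMap]

theorem det_edgeC₂_dvd : edgeC₂.det ∣ X := by
  refine dvd_X_of_eq_mul (e := (1 + X) * (1 + asX)) ?_ (by simp)
  rw [edgeC₂, Matrix.det_fin_two_of]
  grind

theorem d_mem_fixer_t : d ∈ fixer rhoTHom := by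
  refine mem_fixer_of_hasRep (N :=
    !![(1 + asX + asX ^ 2) * (1 + X), (1 + X ^ 2) * (1 + asX ^ 3) * (1 + X);
      X, (1 + asX + asX ^ 2) * (1 + X)]) (hasRep_t ?_) (by simp [Matrix.det_fin_two])
  obtain ⟨w, hw⟩ := exists_inv_unif_sq_add
  have hw' : (unif ^ 2 + unif)⁻¹ = w := (eq_inv_of_mul_eq_one_left hw).symm
  rw [rhoT_eq _ w hw]
  ext1 i j
  fin_cases i <;> fin_cases j <;>
    simp [D, unitOfNrd, algebraMap_X, hw', -LaurentSeries.coe_algebraMap] <;> grind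

/-- The integral matrix representing `b₁`, which moves the standard vertex along an edge. -/
def edgeB₁ : Matrix (Fin 2) (Fin 2) (PowerSeries (ZMod 2)) :=
  !![(1 + X) * (asX ^ 2 + asX * X + 1 + X), (1 + X) * (asX + asX ^ 4);
      1 + X, (1 + X) * ((asX + 1) * (asX + X))]

theorem hasRep_b₁ : HasRep rhoTHom b₁ edgeB₁ := by
  refine hasRep_t ?_
  rw [edgeB₁]
  obtain ⟨w, hw⟩ := exists_inv_unif_sq_add
  have hw' : (unif ^ 2 + unif)⁻¹ = w := (eq_inv_of_mul_eq_one_left hw).symm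
  rw [rhoT_eq _ w hw]
  ext1 i j
  fin_cases i <;> fin_cases j <;>
    simp [B₁, unitOfNrd, algebraMap_X, hw', -LaurentSeries.coe_algebraMap] <;> grind

theorem det_edgeB₁_dvd : edgeB₁.det ∣ X := by
  refine dvd_X_of_eq_mul (e := (1 + X) ^ 3 * (1 + asX)) ?_ (by simp)
  rw [edgeB₁, Matrix.det_fin_two_of]
  grind

/-- The integral matrix representing `c₁`, which moves the standard vertex along an edge. -/
def edgeC₁ : Matrix (Fin 2) (Fin 2) (PowerSeries (ZMod 2)) :=
  !![(1 + X) * (asX + asX ^ 2), (1 + X ^ 2) * (1 + asX ^ 3) * (1 + X);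
      X, (1 + X) * (asX + asX ^ 2)]

theorem hasRep_c₁ : HasRep rhoTHom c₁ edgeC₁ := by
  refine hasRep_t ?_
  rw [edgeC₁]
  obtain ⟨w, hw⟩ := exists_inv_unif_sq_add
  have hw' : (unif ^ 2 + unif)⁻¹ = w := (eq_inv_of_mul_eq_one_left hw).symm
  rw [rhoT_eq _ w hw]
  ext1 i j
  fin_cases i <;> fin_cases j <;>
    simp [C₁, unitOfNrd, algebraMap_X, hw', -LaurentSeries.coe_algebraMap] <;> grind

theorem det_edgeC₁_dvd : edgeC₁.det ∣ X := by
  refine dvd_X_of_eq_mul (e := (1 + X) ^ 3 * (1 + asX)) ?_ (by simp)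
  rw [edgeC₁, Matrix.det_fin_two_of]
  grind

theorem isEdgePair_edge_y : IsEdgePair (residue edgeB₂) (residue edgeC₂) := by
  convert isEdgePair_y using 1 <;> ext i j <;> fin_cases i <;> fin_cases j <;>
    simp [edgeB₂, edgeC₂]

theorem isEdgePair_edge_t : IsEdgePair (residue edgeB₁) (residue edgeC₁) := by
  convert isEdgePair_t using 1 <;> ext i j <;> fin_cases i <;> fin_cases j <;>
    simp [edgeB₁, edgeC₁]

end Vertices

/-! ### The presentation -/

section Decomposition

variable {H : Type*} [Group H]

/-- If letters `b` can be moved past letters `a`, then they can be moved past products of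
letters `a`. -/
theorem exists_mul_eq_mul_of_mem_closure {b c b' c' : H} (hc : c ^ 2 = 1)
    (h : ∀ s t : Letter, ∃ s' t' : Letter,
      s.eval b' c' * t.eval b c = t'.eval b c * s'.eval b' c')
    {α : H} (hα : α ∈ Subgroup.closure {b, c}) (s : Letter) :
    ∃ α' ∈ Subgroup.closure {b, c}, ∃ s' : Letter, s.eval b' c' * α = α' * s'.eval b' c' := by
  -- Passing one letter leaves exactly one letter `s₁`, so the induction along the word `α` can
  -- continue with it.
  have key : ∀ (t : Letter) (y : H),
      (∀ s : Letter, ∃ α' ∈ Subgroup.closure {b, c}, ∃ s' : Letter,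
        s.eval b' c' * y = α' * s'.eval b' c') →
      ∀ s : Letter, ∃ α' ∈ Subgroup.closure {b, c}, ∃ s' : Letter,
        s.eval b' c' * (t.eval b c * y) = α' * s'.eval b' c' := by
    intro t y ih s
    obtain ⟨s₁, t₁, h₁⟩ := h s t
    obtain ⟨α', hα', s₂, h₂⟩ := ih s₁
    exact ⟨t₁.eval b c * α', mul_mem (Letter.eval_mem b c t₁) hα', s₂, by
      rw [← mul_assoc, h₁, mul_assoc, h₂, mul_assoc]⟩
  induction hα using Subgroup.closure_induction_left generalizing s with
  | one => exact ⟨1, one_mem _, s, by simp⟩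
  | mul_left x hx y hy ih =>
    rcases hx with rfl | rfl
    · exact key .pos y ih s
    · exact key .invol y ih s
  | inv_mul_cancel x hx y hy ih =>
    rcases hx with rfl | rfl
    · exact key .neg y ih s
    · have := key (.inv .invol) y ih s
      rwa [Letter.eval_inv hc] at this

variable {b₁ b₂ c₁ c₂ d : H}

/-- Each mixed relator of length four is a square whose sides alternate between the two alphabets.
Its four corners, read up to inversion, give four of the nine exchange rules (`r1`–`r4` and
`s1`–`s4`); commutation of `c₁` and `c₂` gives the ninth. -/
theorem exists_letter_mul_eq (h1 : c₁ ^ 2 = 1) (h2 : c₂ ^ 2 = 1) (h12 : c₁ * c₂ = c₂ * c₁)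
    (hr : b₁ * b₂ * c₁ * b₂ = 1) (hs : b₁ * c₂ * b₁ = b₂) (s t : Letter) :
    ∃ s' t' : Letter, s.eval b₂ c₂ * t.eval b₁ c₁ = t'.eval b₁ c₁ * s'.eval b₂ c₂ := by
  have i1 : c₁⁻¹ = c₁ := inv_eq_of_mul_eq_one_left (by rw [← pow_two, h1])
  have i2 : c₂⁻¹ = c₂ := inv_eq_of_mul_eq_one_left (by rw [← pow_two, h2])
  have r1 : b₂ * c₁ = b₁⁻¹ * b₂⁻¹ := by
    rw [eq_mul_inv_iff_mul_eq, eq_inv_iff_mul_eq_one, mul_eq_one_iff_eq_inv,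
      eq_inv_iff_mul_eq_one.2 (by simpa only [mul_assoc] using hr : b₁ * (b₂ * c₁ * b₂) = 1), inv_inv]
  have r2 : b₂ * b₁ = c₁ * b₂⁻¹ := by
    rw [← inv_inj, mul_inv_rev, mul_inv_rev, inv_inv, i1, r1]
  have r3 : b₂⁻¹ * c₁ = b₁ * b₂ := by
    have : b₁ * b₂ * c₁ = b₂⁻¹ := eq_inv_of_mul_eq_one_left hr
    rw [← this, mul_assoc, ← pow_two, h1, mul_one]
  have r4 : b₂⁻¹ * b₁⁻¹ = c₁ * b₂ := by
    rw [← mul_inv_rev]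
    exact inv_eq_of_mul_eq_one_right (by simpa only [mul_assoc] using hr)
  have s1 : c₂ * b₁ = b₁⁻¹ * b₂ := by
    rw [← hs]; group
  have s2 : c₂ * b₁⁻¹ = b₁ * b₂⁻¹ := by
    rw [← hs]; simp [mul_assoc, i2]
  have s3 : b₂ * b₁⁻¹ = b₁ * c₂ := by
    rw [← hs]; group
  have s4 : b₂⁻¹ * b₁ = b₁⁻¹ * c₂ := by
    rw [← hs]; simp [mul_assoc, i2]
  cases s <;> cases t
  · exact ⟨.neg, .invol, r2⟩
  · exact ⟨.invol, .pos, s3⟩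
  · exact ⟨.neg, .neg, r1⟩
  · exact ⟨.invol, .neg, s4⟩
  · exact ⟨.pos, .invol, r4⟩
  · exact ⟨.pos, .pos, r3⟩
  · exact ⟨.pos, .neg, s1⟩
  · exact ⟨.neg, .pos, s2⟩
  · exact ⟨.invol, .invol, h12.symm⟩

/-- Conjugation by an involution inverting `b` and fixing `c` preserves `⟨b, c⟩`. -/
theorem mul_mul_mem_closure {b c : H} (hd : d ^ 2 = 1) (hb : d * b * d * b = 1)
    (hc : c * d = d * c) {α : H} (hα : α ∈ Subgroup.closure {b, c}) :
    d * α * d ∈ Subgroup.closure {b, c} := by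
  have hd' : d * d = 1 := by rw [← pow_two, hd]
  have e : ∀ x y, d * (x * y) * d = (d * x * d) * (d * y * d) := by
    intro x y
    have : d * x * d * (d * y * d) = d * x * (d * d) * y * d := by simp only [mul_assoc]
    rw [this, hd', mul_one, ← mul_assoc d x]
  have hinv : ∀ x, d * x⁻¹ * d = (d * x * d)⁻¹ := by
    intro x
    rw [mul_inv_rev, mul_inv_rev, inv_eq_of_mul_eq_one_left hd', mul_assoc]
  induction hα using Subgroup.closure_induction with
  | mem x hx =>
    rcases hx with rfl | rfl
    · rw [eq_inv_of_mul_eq_one_left hb]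
      exact inv_mem (Subgroup.subset_closure (by simp))
    · rw [← hc, mul_assoc, hd', mul_one]
      exact Subgroup.subset_closure (by simp)
  | one => simp [hd']
  | mul x y _ _ hx hy => rw [e]; exact mul_mem hx hy
  | inv x _ hx => rw [hinv]; exact inv_mem hx

/-- A group with generators satisfying the ten relations is the product of the subgroups
`⟨d⟩`, `⟨b₁, c₁⟩` and `⟨b₂, c₂⟩`. -/
theorem exists_eq_mul_mul (h1 : c₁ ^ 2 = 1) (h2 : c₂ ^ 2 = 1) (hd : d ^ 2 = 1)
    (h12 : c₁ * c₂ = c₂ * c₁) (h1d : c₁ * d = d * c₁) (h2d : c₂ * d = d * c₂)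
    (hr : b₁ * b₂ * c₁ * b₂ = 1) (hs : b₁ * c₂ * b₁ = b₂)
    (hdb₁ : d * b₁ * d * b₁ = 1) (hdb₂ : d * b₂ * d * b₂ = 1) {γ : H}
    (hγ : γ ∈ Subgroup.closure {b₁, b₂, c₁, c₂, d}) :
    ∃ δ, (δ = 1 ∨ δ = d) ∧ ∃ α ∈ Subgroup.closure {b₁, c₁}, ∃ β ∈ Subgroup.closure {b₂, c₂},
      γ = δ * α * β := by
  have hd' : d * d = 1 := by rw [← pow_two, hd]
  -- The products `δαβ` contain `1`; `keyA`, `keyB` and `keyD` show that they are stable under left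
  -- multiplication by the generators and their inverses.
  have keyA : ∀ a ∈ Subgroup.closure {b₁, c₁}, ∀ y, (∃ δ, (δ = 1 ∨ δ = d) ∧
      ∃ α ∈ Subgroup.closure {b₁, c₁}, ∃ β ∈ Subgroup.closure {b₂, c₂}, y = δ * α * β) →
      ∃ δ, (δ = 1 ∨ δ = d) ∧
      ∃ α ∈ Subgroup.closure {b₁, c₁}, ∃ β ∈ Subgroup.closure {b₂, c₂}, a * y = δ * α * β := by
    rintro a ha _ ⟨δ, rfl | rfl, α, hα, β, hβ, rfl⟩
    · exact ⟨1, .inl rfl, a * α, mul_mem ha hα, β, hβ, by simp [mul_assoc]⟩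
    · refine ⟨δ, .inr rfl, δ * a * δ * α,
        mul_mem (mul_mul_mem_closure hd hdb₁ h1d ha) hα, β, hβ, ?_⟩
      have : δ * (δ * a * δ * α) * β = (δ * δ) * a * δ * α * β := by simp only [mul_assoc]
      rw [this, hd']
      simp only [mul_assoc, one_mul]
  have move := @exists_letter_mul_eq H _ b₁ b₂ c₁ c₂ h1 h2 h12 hr hs
  have keyB : ∀ s : Letter, ∀ y, (∃ δ, (δ = 1 ∨ δ = d) ∧
      ∃ α ∈ Subgroup.closure {b₁, c₁}, ∃ β ∈ Subgroup.closure {b₂, c₂}, y = δ * α * β) →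
      ∃ δ, (δ = 1 ∨ δ = d) ∧ ∃ α ∈ Subgroup.closure {b₁, c₁},
      ∃ β ∈ Subgroup.closure {b₂, c₂}, s.eval b₂ c₂ * y = δ * α * β := by
    rintro s _ ⟨δ, hδ, α, hα, β, hβ, rfl⟩
    have hs' : ∃ s' : Letter, s.eval b₂ c₂ * δ = δ * s'.eval b₂ c₂ := by
      rcases hδ with rfl | rfl
      · exact ⟨s, by simp⟩
      have hb : δ * b₂ * δ = b₂⁻¹ := eq_inv_of_mul_eq_one_left hdb₂
      have hb' : b₂ * δ = δ * b₂⁻¹ := by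
        rw [← hb, ← mul_assoc, ← mul_assoc, hd', one_mul]
      cases s
      · exact ⟨.neg, hb'⟩
      · refine ⟨.pos, ?_⟩
        show b₂⁻¹ * δ = δ * b₂
        rw [← hb, mul_assoc, hd', mul_one]
      · exact ⟨.invol, h2d⟩
    obtain ⟨s', hs'⟩ := hs'
    obtain ⟨α', hα', t, ht⟩ := exists_mul_eq_mul_of_mem_closure h1 move hα s'
    refine ⟨δ, hδ, α', hα', t.eval b₂ c₂ * β, mul_mem (Letter.eval_mem _ _ _) hβ, ?_⟩
    rw [← mul_assoc, ← mul_assoc, hs', mul_assoc δ, ht]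
    simp only [mul_assoc]
  have keyD : ∀ y, (∃ δ, (δ = 1 ∨ δ = d) ∧
      ∃ α ∈ Subgroup.closure {b₁, c₁}, ∃ β ∈ Subgroup.closure {b₂, c₂}, y = δ * α * β) →
      ∃ δ, (δ = 1 ∨ δ = d) ∧
      ∃ α ∈ Subgroup.closure {b₁, c₁}, ∃ β ∈ Subgroup.closure {b₂, c₂}, d * y = δ * α * β := by
    rintro _ ⟨δ, rfl | rfl, α, hα, β, hβ, rfl⟩
    · exact ⟨d, .inr rfl, α, hα, β, hβ, by simp [mul_assoc]⟩
    · exact ⟨1, .inl rfl, α, hα, β, hβ, by simp only [← mul_assoc, hd']⟩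
  have inv_c₂ : c₂⁻¹ = c₂ := inv_eq_of_mul_eq_one_left (by rw [← pow_two, h2])
  have inv_d : d⁻¹ = d := inv_eq_of_mul_eq_one_left hd'
  induction hγ using Subgroup.closure_induction_left with
  | one => exact ⟨1, .inl rfl, 1, one_mem _, 1, one_mem _, by simp⟩
  | mul_left x hx y hy ih =>
    rcases hx with rfl | rfl | rfl | rfl | rfl
    · exact keyA _ (Subgroup.subset_closure (by simp)) y ih
    · exact keyB .pos y ih
    · exact keyA _ (Subgroup.subset_closure (by simp)) y ih
    · exact keyB .invol y ih
    · exact keyD y ih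
  | inv_mul_cancel x hx y hy ih =>
    rcases hx with rfl | rfl | rfl | rfl | rfl
    · exact keyA _ (inv_mem (Subgroup.subset_closure (by simp))) y ih
    · exact keyB .neg y ih
    · exact keyA _ (inv_mem (Subgroup.subset_closure (by simp))) y ih
    · rw [inv_c₂]; exact keyB .invol y ih
    · rw [inv_d]; exact keyD y ih

end Decomposition

/-! ### Injectivity of the map from the presented group -/

theorem d_ne_one : d ≠ 1 := by
  intro h
  obtain ⟨r, hr⟩ := exists_smul_of_mk_eq_mk (x := D) (y := 1) h
  have := congrArg QuaternionAlgebra.imK hr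
  simp [D, unitOfNrd] at this

theorem orderOf_d : orderOf d = 2 := orderOf_eq_prime d_sq d_ne_one

theorem relations_of_relators {H : Type*} [Group H] (m : FreeGroup Gen →* H)
    (h : ∀ r ∈ relators, m r = 1) {f : Gen → H} (hf : ∀ s, f s = m (FreeGroup.of s)) :
    f .c₁ ^ 2 = 1 ∧ f .c₂ ^ 2 = 1 ∧ f .d ^ 2 = 1 ∧ f .c₁ * f .c₂ = f .c₂ * f .c₁ ∧
    f .c₁ * f .d = f .d * f .c₁ ∧ f .c₂ * f .d = f .d * f .c₂ ∧
    f .b₁ * f .b₂ * f .c₁ * f .b₂ = 1 ∧ f .b₁ * f .c₂ * f .b₁ = f .b₂ ∧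
    f .d * f .b₁ * f .d * f .b₁ = 1 ∧ f .d * f .b₂ * f .d * f .b₂ = 1 := by
  simpa only [relators, Set.forall_mem_insert, Set.mem_singleton_iff, forall_eq, map_mul, map_pow,
    map_inv, mul_inv_eq_one, ← hf] using h

theorem closure_presented : Subgroup.closure
    {PresentedGroup.of .b₁, PresentedGroup.of .b₂, PresentedGroup.of .c₁,
      PresentedGroup.of .c₂, PresentedGroup.of (rels := relators) .d} = ⊤ := by
  rw [eq_top_iff, ← PresentedGroup.closure_range_of, Subgroup.closure_le]
  rintro _ ⟨s, rfl⟩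
  apply Subgroup.subset_closure
  cases s <;> simp

/-- The order of elimination matters: `α` is known to fix the vertex of the first tree, so `β` is
removed there; the second tree is used only once `β` is gone. -/
theorem presentedToG_injective : Function.Injective presentedToG := by
  rw [injective_iff_map_eq_one]
  intro γ hγ
  obtain ⟨h1, h2, hd, h12, h1d, h2d, hr, hs, hdb₁, hdb₂⟩ :=
    relations_of_relators (PresentedGroup.mk relators) (fun _ hr => PresentedGroup.one_of_mem hr)
      (f := PresentedGroup.of) fun _ => rfl
  obtain ⟨δ, hδ, α, hα, β, hβ, rfl⟩ := exists_eq_mul_mul h1 h2 hd h12 h1d h2d hr hs hdb₁ hdb₂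
    (closure_presented ▸ Subgroup.mem_top γ)
  have hmem : ∀ K : Subgroup G, b₁ ∈ K → c₁ ∈ K → presentedToG α ∈ K := by
    intro K hb hc
    have : Subgroup.closure {PresentedGroup.of .b₁, PresentedGroup.of (rels := relators) .c₁} ≤
        K.comap presentedToG := by
      rw [Subgroup.closure_le]
      rintro _ (rfl | rfl)
      · simpa [Gen.toG] using hb
      · simpa [Gen.toG] using hc
    exact this hα
  have hδmem : ∀ K : Subgroup G, d ∈ K → presentedToG δ ∈ K := by
    intro K hK
    rcases hδ with rfl | rfl
    · rw [map_one]; exact one_mem _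
    · simpa [Gen.toG] using hK
  have hβ1 : β = 1 := by
    refine eq_one_of_mul_eq_one h2 preservesScalars_rhoY (f := presentedToG)
      (by rw [presentedToG_of]; exact hasRep_b₂) (by rw [presentedToG_of]; exact hasRep_c₂)
      isEdgePair_edge_y hβ (g := presentedToG (δ * α)) ?_ (by rw [← map_mul, hγ])
    rw [map_mul]
    exact mul_mem (hδmem _ d_mem_fixer_y) (hmem _ b₁_mem_fixer_y c₁_mem_fixer_y)
  subst hβ1
  rw [mul_one] at hγ ⊢
  have hα1 : α = 1 :=
    eq_one_of_mul_eq_one h1 preservesScalars_rhoT (f := presentedToG)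
      (by rw [presentedToG_of]; exact hasRep_b₁) (by rw [presentedToG_of]; exact hasRep_c₁)
      isEdgePair_edge_t hα (hδmem _ d_mem_fixer_t) (by rw [← map_mul, hγ])
  subst hα1
  rw [mul_one] at hγ ⊢
  rcases hδ with rfl | rfl
  · rfl
  · exact absurd (by simpa [Gen.toG] using hγ) d_ne_one

/-! ### Transitivity of `Λ` on the orbit of the standard vertex -/

/-- Every element of `G(R)` is the product of an element of `Λ` and an element fixing the
standard vertex. -/
theorem exists_mul_mem_fixers (γ : G) :
    ∃ g ∈ Lam, g * γ ∈ fixer rhoYHom ⊓ fixer rhoTHom := by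
  obtain ⟨g, hg, h⟩ := exists_mul_mem_fixer hasRep_b₂ hasRep_c₂ isEdgePair_edge_y
    det_edgeB₂_dvd det_edgeC₂_dvd γ
  obtain ⟨g', hg', h'⟩ := exists_mul_mem_fixer hasRep_b₁ hasRep_c₁ isEdgePair_edge_t
    det_edgeB₁_dvd det_edgeC₁_dvd (g * γ)
  -- The correction in the second tree fixes the standard vertex of the first, so it does not undo
  -- the first correction.
  have hle : Subgroup.closure {b₁, c₁} ≤ fixer rhoYHom := by
    rw [Subgroup.closure_le]
    rintro _ (rfl | rfl)
    exacts [b₁_mem_fixer_y, c₁_mem_fixer_y]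
  refine ⟨g' * g, mul_mem (Subgroup.closure_mono ?_ hg') (Subgroup.closure_mono ?_ hg), ?_⟩
  · rintro _ (rfl | rfl) <;> simp
  · rintro _ (rfl | rfl) <;> simp
  · rw [mul_assoc]
    exact ⟨mul_mem (hle hg') h, h'⟩

section PolynomialQuaternions

open Polynomial

/-! ### Divisibility of reduced norms of polynomial quaternions -/

theorem eval_eq_zero_iff_dvd {f : (ZMod 2)[X]} : (1 + X : (ZMod 2)[X]) ∣ f ↔ f.eval 1 = 0 := by
  have : (1 + X : (ZMod 2)[X]) = X - C 1 := by
    rw [map_one, CharTwo.sub_eq_add, add_comm]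
  rw [this, dvd_iff_isRoot, IsRoot.def]

theorem prime_one_add_X : Prime (1 + X : (ZMod 2)[X]) := by
  have : (1 + X : (ZMod 2)[X]) = X - C 1 := by
    rw [map_one, CharTwo.sub_eq_add, add_comm]
  rw [this]
  exact prime_X_sub_C 1

theorem natDegree_quadratic : (1 + X + X ^ 2 : (ZMod 2)[X]).natDegree = 2 := by
  compute_degree!

theorem irreducible_quadratic : Irreducible (1 + X + X ^ 2 : (ZMod 2)[X]) := by
  apply irreducible_of_degree_le_three_of_not_isRoot
  · rw [natDegree_quadratic]; decide
  · intro x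
    simp only [IsRoot.def, eval_add, eval_one, eval_X, eval_pow]
    revert x
    decide

theorem one_add_X_cube : (1 + X ^ 3 : (ZMod 2)[X]) = (1 + X) * (1 + X + X ^ 2) := by
  grind

/-- At `z = 1` the form is `a² + ab + b²`, the norm form of `𝔽₄` over `𝔽₂`. -/
theorem anisotropic_one_add_X {a b : (ZMod 2)[X]}
    (h : (1 + X : (ZMod 2)[X]) ∣ a ^ 2 + a * b - X * b ^ 2) : (1 + X) ∣ a ∧ (1 + X) ∣ b := by
  simp only [eval_eq_zero_iff_dvd, eval_sub, eval_add, eval_mul, eval_pow, eval_X, one_mul] at h ⊢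
  generalize a.eval 1 = r at *
  generalize b.eval 1 = s at *
  revert r s
  decide

/-- The residue field is `𝔽₄`, with `z ↦ ω` and `ω² + ω = 1`. A zero with `b ≠ 0` gives `c = a/b`
with `c² + c = ω`, whence `c⁴ = c + 1`, against `c⁴ = c` in `𝔽₄`. -/
theorem anisotropic_quadratic {a b : (ZMod 2)[X]}
    (h : (1 + X + X ^ 2 : (ZMod 2)[X]) ∣ a ^ 2 + a * b - X * b ^ 2) :
    (1 + X + X ^ 2) ∣ a ∧ (1 + X + X ^ 2) ∣ b := by
  have : Fact (Irreducible (1 + X + X ^ 2 : (ZMod 2)[X])) := ⟨irreducible_quadratic⟩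
  obtain ⟨q, hq⟩ : ∃ q : (ZMod 2)[X], q = 1 + X + X ^ 2 := ⟨_, rfl⟩
  rw [← hq] at h this ⊢
  simp only [← AdjoinRoot.mk_eq_zero, map_sub, map_add, map_mul, map_pow, AdjoinRoot.mk_X] at h ⊢
  have hω : 1 + AdjoinRoot.root q + AdjoinRoot.root q ^ 2 = 0 := by
    calc _ = AdjoinRoot.mk q (1 + X + X ^ 2) := by simp
      _ = AdjoinRoot.mk q q := by rw [← hq]
      _ = 0 := AdjoinRoot.mk_self
  have : CharP (AdjoinRoot q) 2 :=
    charP_of_injective_algebraMap (algebraMap (ZMod 2) (AdjoinRoot q)).injective 2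
  have hfrob : ∀ s : AdjoinRoot q, s ^ 4 = s := by
    have hω4 : AdjoinRoot.root q ^ 4 = AdjoinRoot.root q := by grind
    intro s
    induction s using AdjoinRoot.induction_on with
    | _ f =>
      induction f using Polynomial.induction_on' with
      | add f g hf hg =>
        rw [map_add]
        have : ∀ x y : AdjoinRoot q, (x + y) ^ 4 = x ^ 4 + y ^ 4 := by
          intro x y
          grind
        rw [this, hf, hg]
      | monomial n c =>
        have hc : c ^ 4 = c := by revert c; decide
        rw [← C_mul_X_pow_eq_monomial, map_mul, map_pow, AdjoinRoot.mk_X, mul_pow, ← pow_mul,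
          mul_comm n, pow_mul, hω4, ← map_pow, ← C_pow, hc]
  generalize AdjoinRoot.mk q a = r at *
  generalize AdjoinRoot.mk q b = s at *
  generalize AdjoinRoot.root q = ω at *
  by_cases hs : s = 0
  · subst hs
    simpa using h
  exfalso
  have h4 := hfrob (r * s⁻¹)
  have hc : (r * s⁻¹) ^ 2 + r * s⁻¹ = ω := by
    field_simp
    grind
  generalize r * s⁻¹ = c at *
  have : c ^ 4 = c + 1 := by grind
  rw [h4] at this
  simp at this

/-- A polynomial quaternion is divisible by a prime `q` ramified in the quaternion algebra if
its reduced norm is divisible by `q²`. -/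
theorem exists_eq_smul_of_sq_dvd_nrd {q h : (ZMod 2)[X]} (hq : Prime q) (hqh : 1 + X ^ 3 = q * h)
    (hh : ¬ q ∣ h) (haniso : ∀ a b : (ZMod 2)[X], q ∣ a ^ 2 + a * b - X * b ^ 2 → q ∣ a ∧ q ∣ b)
    {p : Quat (ZMod 2)[X] X} (hp : q ^ 2 ∣ nrd p) : ∃ p', p = q • p' := by
  have e : nrd p = (p.re ^ 2 + p.re * p.imI - X * p.imI ^ 2) -
      q * (h * (p.imJ ^ 2 + p.imJ * p.imK - X * p.imK ^ 2)) := by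
    rw [nrd]
    linear_combination -(p.imJ ^ 2 + p.imJ * p.imK - X * p.imK ^ 2) * hqh
  rw [e] at hp
  -- Modulo `q` only the form in the first two coordinates survives. Once both are divisible by `q`,
  -- their form is divisible by `q²`, which forces the same on the last two since `q ∤ h`.
  have h1 : q ∣ p.re ^ 2 + p.re * p.imI - X * p.imI ^ 2 :=
    (dvd_sub_left (dvd_mul_right _ _)).1 ((dvd_pow_self q two_ne_zero).trans hp)
  obtain ⟨⟨a, ha⟩, ⟨b, hb⟩⟩ := haniso _ _ h1
  have h2 : q ^ 2 ∣ p.re ^ 2 + p.re * p.imI - X * p.imI ^ 2 :=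
    ⟨a ^ 2 + a * b - X * b ^ 2, by rw [ha, hb]; ring⟩
  have h3 := (dvd_sub_right h2).1 hp
  rw [pow_two, mul_dvd_mul_iff_left hq.ne_zero] at h3
  obtain ⟨⟨c, hc⟩, ⟨d, hd⟩⟩ := haniso _ _ ((hq.dvd_or_dvd h3).resolve_left hh)
  exact ⟨⟨a, b, c, d⟩, by ext1 <;> simp [ha, hb, hc, hd]⟩

theorem dvd_mul_of_dvd_pow_mul {q d s : (ZMod 2)[X]} (hq : Prime q) {n : ℕ}
    (hd : d ∣ q ^ n * s) (hq2 : ¬ q ^ 2 ∣ d) : d ∣ q * s := by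
  have cop : ∀ e, ¬ q ∣ e → e ∣ q ^ n * s → e ∣ s := fun e he h =>
    (((hq.irreducible.coprime_iff_not_dvd).2 he).symm.pow_right).dvd_of_dvd_mul_left h
  by_cases h : q ∣ d
  · obtain ⟨e, rfl⟩ := h
    refine mul_dvd_mul_left q (cop e ?_ ((dvd_mul_left e q).trans hd))
    rintro ⟨f, rfl⟩
    exact hq2 ⟨f, by ring⟩
  · exact (cop d h hd).mul_left q

/-- What remains divides `(1+X)(1+X+X²)`. -/
theorem natDegree_nrd_le {f : (ZMod 2)[X]} {k : ℕ} (hf : f ∣ (X * (1 + X ^ 3)) ^ k)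
    (hX : ¬ X ∣ f) (h1 : ¬ (1 + X) ^ 2 ∣ f) (h2 : ¬ (1 + X + X ^ 2) ^ 2 ∣ f) :
    f.natDegree ≤ 3 := by
  rw [one_add_X_cube, mul_pow, mul_pow] at hf
  have hf' : f ∣ (1 + X) ^ k * (1 + X + X ^ 2) ^ k :=
    (((prime_X.irreducible.coprime_iff_not_dvd).2 hX).symm.pow_right).dvd_of_dvd_mul_left hf
  have hf2 := dvd_mul_of_dvd_pow_mul prime_one_add_X hf' h1
  rw [mul_comm] at hf2
  have hf3 := dvd_mul_of_dvd_pow_mul irreducible_quadratic.prime hf2 h2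
  have hne : (1 + X + X ^ 2 : (ZMod 2)[X]) * (1 + X) ≠ 0 :=
    mul_ne_zero irreducible_quadratic.ne_zero prime_one_add_X.ne_zero
  refine (natDegree_le_of_dvd hf3 hne).trans ?_
  compute_degree

/-- The polynomial quaternions `p` within certain degree bounds are constants or multiples
of `D`. -/
theorem eq_of_degree_bounds {p : Quat (ZMod 2)[X] X} {m : ℕ} (hm : m ≤ 1)
    (hdeg : (nrd p).natDegree = 2 * m) (hX : ¬ X ∣ nrd p) (h1 : ¬ (1 + X) ^ 2 ∣ nrd p)
    (h₁ : p.imI.natDegree ≤ m) (h₃ : (X * p.imK).natDegree ≤ m)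
    (h₀ : (p.re + X ^ 2 * p.imK).natDegree ≤ m)
    (h₂ : (X * p.imI + X ^ 2 * p.imJ).natDegree ≤ m) :
    (∃ r : ZMod 2, p = ⟨C r, 0, 0, 0⟩) ∨ p = ⟨1 + X + X ^ 2, 0, 0, 1⟩ := by
  obtain ⟨x₀, x₁, x₂, x₃⟩ := p
  simp only at h₀ h₁ h₂ h₃
  have hXmul : ∀ f : (ZMod 2)[X], (X * f).natDegree ≤ 0 → f = 0 := by
    intro f hf
    by_contra h0
    rw [natDegree_X_mul h0] at hf
    omega
  have hXmul1 : ∀ f : (ZMod 2)[X], (X * f).natDegree ≤ 1 → ∃ c, f = C c := by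
    intro f hf
    by_cases h0 : f = 0
    · exact ⟨0, by rw [h0, map_zero]⟩
    rw [natDegree_X_mul h0] at hf
    exact ⟨_, eq_C_of_natDegree_le_zero (by omega)⟩
  have e₂ : X * x₁ + X ^ 2 * x₂ = X * (x₁ + X * x₂) := by ring
  rw [e₂] at h₂
  interval_cases m
  · left
    obtain rfl := hXmul _ h₃
    have h := hXmul _ h₂
    rw [eq_C_of_natDegree_le_zero h₁] at h
    have hx₁ : x₁.coeff 0 = 0 := by simpa using congrArg (coeff · 0) h
    rw [hx₁, map_zero, zero_add] at h
    obtain rfl : x₂ = 0 := (mul_eq_zero.1 h).resolve_left X_ne_zero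
    rw [mul_zero, add_zero] at h₀
    refine ⟨x₀.coeff 0, ?_⟩
    ext1
    · exact eq_C_of_natDegree_le_zero h₀
    · rw [eq_C_of_natDegree_le_zero h₁, hx₁, map_zero]
    · rfl
    · rfl
  · right
    obtain ⟨e, rfl⟩ := hXmul1 _ h₃
    obtain ⟨g, hg⟩ := hXmul1 _ h₂
    obtain ⟨f, rfl⟩ : ∃ f, x₂ = C f := by
      apply hXmul1
      have : X * x₂ = C g - x₁ := by rw [← hg]; ring
      rw [this]
      exact (natDegree_sub_le _ _).trans (by simpa using h₁)
    obtain rfl : x₁ = C g - X * C f := by rw [← hg]; ring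
    obtain ⟨a, b, hab⟩ := exists_eq_X_add_C_of_natDegree_le_one h₀
    obtain rfl : x₀ = C a * X + C b - X ^ 2 * C e := by rw [← hab]; ring
    have hn : nrd (⟨C a * X + C b - X ^ 2 * C e, C g - X * C f, C f, C e⟩ : Quat (ZMod 2)[X] X) =
        C (a ^ 2 + e * g + a * f) * X ^ 2 + C (a * g + b * f + g ^ 2 + e ^ 2) * X +
          C (b ^ 2 + b * g + f ^ 2 + f * e) := by
      simp only [nrd, map_add, map_mul, map_pow]
      generalize C a = a at *
      generalize C b = b at *
      generalize C e = e at *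
      generalize C f = f at *
      generalize C g = g at *
      grind
    rw [hn] at hdeg hX h1
    generalize hα : a ^ 2 + e * g + a * f = α at *
    generalize hβ : a * g + b * f + g ^ 2 + e ^ 2 = β at *
    generalize hγ : b ^ 2 + b * g + f ^ 2 + f * e = γ at *
    -- The norm must be `X² + X + 1`: its degree is two, `X` does not divide it, and `X² + 1 =
    -- (1+X)²` is excluded. Among the 32 values of `(a, b, e, f, g)` only those of `D` attain it.
    have h01 : ∀ x : ZMod 2, x = 0 ∨ x = 1 := by decide
    have hα1 : α = 1 := by
      refine (h01 α).resolve_left ?_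
      rintro rfl
      have := natDegree_linear_le (a := β) (b := γ)
      rw [map_zero, zero_mul, zero_add] at hdeg
      omega
    have hγ1 : γ = 1 := by
      refine (h01 γ).resolve_left ?_
      rintro rfl
      exact hX ⟨C α * X + C β, by rw [map_zero]; ring⟩
    have hβ1 : β = 1 := by
      refine (h01 β).resolve_left ?_
      rintro rfl
      refine h1 ⟨1, ?_⟩
      rw [hα1, hγ1, map_zero, map_one]
      grind
    have key : ∀ a b e f g : ZMod 2, a ^ 2 + e * g + a * f = 1 →
        a * g + b * f + g ^ 2 + e ^ 2 = 1 → b ^ 2 + b * g + f ^ 2 + f * e = 1 →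
        a = 1 ∧ b = 1 ∧ e = 1 ∧ f = 0 ∧ g = 0 := by decide
    obtain ⟨rfl, rfl, rfl, rfl, rfl⟩ := key a b e f g (hα.trans hα1) (hβ.trans hβ1) (hγ.trans hγ1)
    ext1 <;> simp
    grind

end PolynomialQuaternions

section Stabilizer

open Polynomial

/-! ### Polynomial quaternions fixing the standard vertex -/

/-- A scalar multiple of an invertible integral matrix. -/
def IsVertexMatrix (g : Matrix (Fin 2) (Fin 2) LocalField) : Prop :=
  ∃ N, IsUnit N.det ∧ ∃ c : LocalField, c ≠ 0 ∧ g = c • toLocal N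

theorem IsVertexMatrix.of_smul {g : Matrix (Fin 2) (Fin 2) LocalField} {k : LocalField}
    (h : IsVertexMatrix (k • g)) : IsVertexMatrix g := by
  obtain ⟨N, hN, c, hc, h⟩ := h
  have hk : k ≠ 0 := by
    rintro rfl
    have h1 : c ^ 2 * algebraMap _ LocalField N.det = 0 := by
      have := congrArg Matrix.det h
      rw [zero_smul, Matrix.det_smul, ← RingHom.map_det, Matrix.det_zero, Fintype.card_fin] at this
      exact this.symm
    exact mul_ne_zero (pow_ne_zero 2 hc)
      ((map_ne_zero_iff _ algebraMap_localField_injective).2 hN.ne_zero) h1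
  exact ⟨N, hN, k⁻¹ * c, mul_ne_zero (inv_ne_zero hk) hc, by
    rw [mul_smul, ← h, inv_smul_smul₀ hk]⟩

/-- A polynomial quaternion as an element of `𝔒`. -/
def toOrder (p : Quat (ZMod 2)[X] X) : Order :=
  ⟨algebraMap _ _ p.re, algebraMap _ _ p.imI, algebraMap _ _ p.imJ, algebraMap _ _ p.imK⟩

theorem nrd_toOrder (p : Quat (ZMod 2)[X] X) :
    nrd (toOrder p) = algebraMap _ CoeffRing (nrd p) := by
  simp [nrd, toOrder, z]

theorem toOrder_smul (r : (ZMod 2)[X]) (p : Quat (ZMod 2)[X] X) :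
    toOrder (r • p) = algebraMap _ CoeffRing r • toOrder p := by
  ext1 <;> simp [toOrder] <;> rw [Algebra.smul_def]

theorem X_mul_one_add_X_cube_ne_zero : (X * (1 + X ^ 3) : (ZMod 2)[X]) ≠ 0 := by
  rw [one_add_X_cube]
  exact mul_ne_zero X_ne_zero
    (mul_ne_zero prime_one_add_X.ne_zero irreducible_quadratic.ne_zero)

theorem map_aeval {A B : Type*} [CommRing A] [CommRing B] [Algebra (ZMod 2) A]
    [Algebra (ZMod 2) B] (f : A →+* B) (a : A) (q : (ZMod 2)[X]) :
    f (aeval a q) = aeval (f a) q := by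
  rw [aeval_def, hom_eval₂, Subsingleton.elim (f.comp (algebraMap _ _)) (algebraMap _ _),
    ← aeval_def]

theorem rhoY_smul (r : CoeffRing) (x : Order) : rhoY (r • x) = embY r • rhoY x := by
  rw [Algebra.smul_def, ← rhoYHom_apply, map_mul, rhoYHom_apply, rhoYHom_apply, rhoY_algebraMap,
    smul_one_mul]

theorem rhoT_smul (r : CoeffRing) (x : Order) : rhoT (r • x) = embT r • rhoT x := by
  rw [Algebra.smul_def, ← rhoTHom_apply, map_mul, rhoTHom_apply, rhoTHom_apply, rhoT_algebraMap,
    smul_one_mul]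

theorem embY_algebraMap (q : (ZMod 2)[X]) :
    embY (algebraMap _ CoeffRing q) = algebraMap _ LocalField (aeval asX q) := by
  rw [embY, specialize_algebraMap, map_aeval]
  simp [asX, algebraMap_X, -LaurentSeries.coe_algebraMap]

theorem embT_algebraMap (q : (ZMod 2)[X]) :
    embT (algebraMap _ CoeffRing q) = aeval (unif ^ 2 + unif)⁻¹ q := by
  rw [embT, specialize_algebraMap]

theorem constantCoeff_aeval_asX (q : (ZMod 2)[X]) :
    PowerSeries.constantCoeff (aeval asX q) = q.eval 0 := by
  rw [map_aeval]
  simp [coe_aeval_eq_eval]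

theorem X_dvd_iff_constantCoeff {q : (ZMod 2)[X]} :
    X ∣ q ↔ PowerSeries.constantCoeff (aeval asX q) = 0 := by
  rw [constantCoeff_aeval_asX, X_dvd_iff, coeff_zero_eq_eval_zero]

/-- The determinant controls a scaling factor only through its square; integral closedness of
`𝔽₂[[X]]` recovers the factor itself. -/
theorem mem_range_of_sq_mem_range {c : LocalField}
    (h : c ^ 2 ∈ (algebraMap (PowerSeries (ZMod 2)) LocalField).range) :
    c ∈ (algebraMap (PowerSeries (ZMod 2)) LocalField).range := by
  obtain ⟨a, ha⟩ := h
  exact IsIntegrallyClosed.exists_algebraMap_eq_of_isIntegral_pow two_pos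
    (ha ▸ isIntegral_algebraMap)

/-- A polynomial quaternion fixing the standard vertex at the place `z = 0` is divisible by `z`
if its reduced norm is. -/
theorem exists_eq_X_smul {p : Quat (ZMod 2)[X] X} (hp : IsVertexMatrix (rhoY (toOrder p)))
    (hX : X ∣ nrd p) : ∃ p', p = (X : (ZMod 2)[X]) • p' := by
  obtain ⟨N, hN, c, hc, h⟩ := hp
  have hdet : algebraMap _ LocalField (aeval asX (nrd p)) =
      c ^ 2 * algebraMap _ LocalField N.det := by
    rw [← embY_algebraMap, ← nrd_toOrder, ← det_rhoY, h, Matrix.det_smul, ← RingHom.map_det,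
      Fintype.card_fin]
  obtain ⟨e, he⟩ := isUnit_iff_exists_inv.1 hN
  have hc2 : c ^ 2 = algebraMap _ LocalField (aeval asX (nrd p) * e) := by
    rw [map_mul, hdet, mul_assoc, ← map_mul, he, map_one, mul_one]
  obtain ⟨a, rfl⟩ := mem_range_of_sq_mem_range ⟨_, hc2.symm⟩
  rw [← map_pow] at hc2
  have ha2 := algebraMap_localField_injective hc2
  have ha : PowerSeries.constantCoeff a = 0 := by
    have := congrArg PowerSeries.constantCoeff ha2
    rw [map_mul, X_dvd_iff_constantCoeff.1 hX, zero_mul, map_pow] at this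
    exact pow_eq_zero_iff two_ne_zero |>.1 this
  have hent : ∀ i j, rhoY (toOrder p) i j = algebraMap _ LocalField (a * N i j) := by
    intro i j
    rw [h, map_mul]
    rfl
  rw [rhoY_eq] at hent
  simp only [toOrder, embY_algebraMap, ← algebraMap_X, ← map_mul, ← map_add,
    ← map_pow, ← map_one (algebraMap (PowerSeries (ZMod 2)) LocalField)] at hent
  -- Modulo `X` the entries are `x₀`, `x₂`, `x₂ + x₃`, `x₀ + x₁`; all vanish because `a` is
  -- divisible by `X`.
  have h00 := congrArg PowerSeries.constantCoeff (algebraMap_localField_injective (hent 0 0))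
  have h01 := congrArg PowerSeries.constantCoeff (algebraMap_localField_injective (hent 0 1))
  have h10 := congrArg PowerSeries.constantCoeff (algebraMap_localField_injective (hent 1 0))
  have h11 := congrArg PowerSeries.constantCoeff (algebraMap_localField_injective (hent 1 1))
  simp only [map_add, map_mul, map_pow, map_one, PowerSeries.constantCoeff_X, ha, mul_zero,
    zero_mul, add_zero] at h00 h01 h10 h11
  simp at h01
  rw [h00, zero_add, mul_one] at h11
  rw [h01, zero_add, mul_one] at h10
  rw [← X_dvd_iff_constantCoeff] at h00 h01 h10 h11
  obtain ⟨x₀, e₀⟩ := h00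
  obtain ⟨x₁, e₁⟩ := h11
  obtain ⟨x₂, e₂⟩ := h01
  obtain ⟨x₃, e₃⟩ := h10
  exact ⟨⟨x₀, x₁, x₂, x₃⟩, by ext1 <;> simp [e₀, e₁, e₂, e₃]⟩

/-! ### Pole orders at infinity -/

/-- As `z = u⁻¹` has a simple pole at `t = 0`, the pole order of `q(z)` is the degree of `q`. The
unit comes from the reversed polynomial at `u`, whose constant term is the leading coefficient of
`q`, and from `t/u = (1+t)⁻¹`. -/
theorem exists_unit_eq_aeval {q : (ZMod 2)[X]} (hq : q ≠ 0) :
    ∃ v : PowerSeries (ZMod 2), IsUnit v ∧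
      unif ^ q.natDegree * aeval (unif ^ 2 + unif)⁻¹ q = algebraMap _ LocalField v := by
  have h1X : IsUnit (1 + PowerSeries.X : PowerSeries (ZMod 2)) := by
    rw [PowerSeries.isUnit_iff_constantCoeff]; simp
  obtain ⟨s, hs⟩ := isUnit_iff_exists_inv'.1 h1X
  have hs' : algebraMap _ LocalField s * (1 + unif) = 1 := by
    rw [← algebraMap_X, ← map_one (algebraMap (PowerSeries (ZMod 2)) LocalField), ← map_add,
      ← map_mul, hs]
  have hu : unif = (unif ^ 2 + unif) * algebraMap _ LocalField s := by
    linear_combination (-unif) * hs'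
  refine ⟨s ^ q.natDegree * aeval asX q.reverse, ?_, ?_⟩
  · refine IsUnit.mul ((IsUnit.of_mul_eq_one _ hs).pow _) ?_
    rw [PowerSeries.isUnit_iff_constantCoeff, constantCoeff_aeval_asX,
      ← coeff_zero_eq_eval_zero, coeff_zero_reverse, isUnit_iff_ne_zero]
    exact leadingCoeff_ne_zero.2 hq
  · let _ := invertibleOfNonzero (inv_ne_zero unif_sq_add_ne_zero)
    have h := eval₂_reverse_mul_pow (algebraMap (ZMod 2) LocalField) (unif ^ 2 + unif)⁻¹ q
    rw [invOf_eq_inv, inv_inv] at h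
    have hus : unif * (unif ^ 2 + unif)⁻¹ = algebraMap _ LocalField s := by
      rw [mul_inv_eq_iff_eq_mul₀ unif_sq_add_ne_zero, mul_comm]
      exact hu
    rw [aeval_def, ← h, map_mul, map_pow, map_aeval, ← hus, ← aeval_def]
    simp only [asX, map_add, map_pow, algebraMap_X]
    ring

theorem natDegree_le_of_mem_range {q : (ZMod 2)[X]} {m : ℕ}
    (h : unif ^ m * aeval (unif ^ 2 + unif)⁻¹ q ∈
      (algebraMap (PowerSeries (ZMod 2)) LocalField).range) : q.natDegree ≤ m := by
  by_cases hq : q = 0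
  · simp [hq]
  by_contra! hlt
  obtain ⟨v, hv, he⟩ := exists_unit_eq_aeval hq
  obtain ⟨a, ha⟩ := h
  obtain ⟨k, hk⟩ := Nat.exists_eq_add_of_lt hlt
  have : v = PowerSeries.X ^ (k + 1) * a := by
    apply algebraMap_localField_injective
    rw [← he, map_mul, map_pow, algebraMap_X, ha, hk]
    ring
  rw [this, PowerSeries.isUnit_iff_constantCoeff] at hv
  simp at hv

/-- The reduced norm of a polynomial quaternion fixing the standard vertex at infinity has even
degree, which bounds the pole order of the quaternion. -/
theorem exists_natDegree_eq_two_mul {p : Quat (ZMod 2)[X] X}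
    (hp : IsVertexMatrix (rhoT (toOrder p))) (h0 : nrd p ≠ 0) :
    ∃ m, (nrd p).natDegree = 2 * m ∧ ∀ i j, unif ^ m * rhoT (toOrder p) i j ∈
      (algebraMap (PowerSeries (ZMod 2)) LocalField).range := by
  obtain ⟨N, hN, c, hc, h⟩ := hp
  have hdet : aeval (unif ^ 2 + unif)⁻¹ (nrd p) = c ^ 2 * algebraMap _ LocalField N.det := by
    rw [← embT_algebraMap, ← nrd_toOrder, ← det_rhoT, h, Matrix.det_smul, ← RingHom.map_det,
      Fintype.card_fin]
  obtain ⟨v, hv, he⟩ := exists_unit_eq_aeval h0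
  obtain ⟨e, hNe⟩ := isUnit_iff_exists_inv.1 hN
  have hNe' : algebraMap _ LocalField N.det * algebraMap _ LocalField e = 1 := by
    rw [← map_mul, hNe, map_one]
  rw [hdet] at he
  have he' : unif ^ (nrd p).natDegree * c ^ 2 = algebraMap _ LocalField (v * e) := by
    rw [map_mul, ← he]
    linear_combination (-(unif ^ (nrd p).natDegree * c ^ 2)) * hNe'
  rcases Nat.even_or_odd' (nrd p).natDegree with ⟨m, hm | hm⟩
  · refine ⟨m, hm, fun i j => ?_⟩
    obtain ⟨a, ha⟩ := mem_range_of_sq_mem_range (c := unif ^ m * c)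
      ⟨v * e, by rw [← he', hm]; ring⟩
    refine ⟨a * N i j, ?_⟩
    rw [map_mul, ha, h, mul_assoc]
    rfl
  -- In odd degree, one more factor `t` would make `X` times a unit a square.
  · exfalso
    have h1 : (unif ^ (m + 1) * c) ^ 2 = algebraMap _ LocalField (PowerSeries.X * (v * e)) := by
      rw [map_mul, ← he', hm, algebraMap_X]; ring
    obtain ⟨a, ha⟩ := mem_range_of_sq_mem_range ⟨_, h1.symm⟩
    rw [← ha, ← map_pow] at h1
    have h2 := algebraMap_localField_injective h1
    obtain ⟨b, rfl⟩ := PowerSeries.X_prime.dvd_of_dvd_pow ⟨_, h2⟩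
    have h3 : PowerSeries.X * b ^ 2 = v * e :=
      mul_left_cancel₀ (PowerSeries.X_ne_zero (R := ZMod 2)) (by rw [← h2]; ring)
    have h4 : IsUnit (v * e) := hv.mul (.of_mul_eq_one_right _ hNe)
    rw [← h3, PowerSeries.isUnit_iff_constantCoeff] at h4
    simp at h4

/-- Degree bounds from integrality at infinity. -/
theorem degree_bounds {p : Quat (ZMod 2)[X] X} {m : ℕ}
    (h : ∀ i j, unif ^ m * rhoT (toOrder p) i j ∈
      (algebraMap (PowerSeries (ZMod 2)) LocalField).range) :
    p.imI.natDegree ≤ m ∧ (X * p.imK).natDegree ≤ m ∧ (p.re + X ^ 2 * p.imK).natDegree ≤ m ∧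
      (X * p.imI + X ^ 2 * p.imJ).natDegree ≤ m := by
  obtain ⟨w, hw⟩ := exists_inv_unif_sq_add
  have hw' : (unif ^ 2 + unif)⁻¹ = w := (eq_inv_of_mul_eq_one_left hw).symm
  rw [rhoT_eq _ w hw] at h
  have h00 := h 0 0
  have h01 := h 0 1
  have h10 := h 1 0
  have h11 := h 1 1
  clear h
  simp only [toOrder, embT_algebraMap, hw', Matrix.of_apply, Matrix.cons_val', Matrix.cons_val_zero,
    Matrix.cons_val_one, Matrix.cons_val_fin_one] at h00 h01 h10 h11
  have hunif : unif ∈ (algebraMap (PowerSeries (ZMod 2)) LocalField).range := ⟨_, algebraMap_X⟩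
  have hinv : ∀ a : PowerSeries (ZMod 2), PowerSeries.constantCoeff a = 1 →
      ∃ s ∈ (algebraMap (PowerSeries (ZMod 2)) LocalField).range,
        s * algebraMap _ LocalField a = 1 := by
    intro a ha
    have : IsUnit a := by rw [PowerSeries.isUnit_iff_constantCoeff, ha]; exact isUnit_one
    obtain ⟨s, hs⟩ := isUnit_iff_exists_inv'.1 this
    exact ⟨_, ⟨s, rfl⟩, by rw [← map_mul, hs, map_one]⟩
  obtain ⟨s, hs, hs1⟩ := hinv (1 + PowerSeries.X) (by simp)
  obtain ⟨k, hk, hk1⟩ := hinv (1 + asX ^ 3) (by simp)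
  simp only [asX, map_add, map_pow, map_one, algebraMap_X] at hs1 hk1
  have hws : unif * w = s := by
    linear_combination (-unif * w) * hs1 + s * hw
  generalize hO : (algebraMap (PowerSeries (ZMod 2)) LocalField).range = O at *
  have key : ∀ q : (ZMod 2)[X], unif ^ m * aeval w q ∈ O → q.natDegree ≤ m := by
    intro q hq
    apply natDegree_le_of_mem_range
    rwa [hw', hO]
  have hu := add_mem (pow_mem hunif 2) hunif
  -- The trace of the matrix is `x₁`.
  have n₁ : unif ^ m * aeval w p.imI ∈ O := by
    convert add_mem h00 h11 using 1
    grind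
  have n₃ : unif ^ m * (w * aeval w p.imK) ∈ O := by
    -- Adding `u(1+u³)` times the lower left entry to the upper right one cancels `x₁` and `x₂` and
    -- leaves `w x₃` times the unit `1+u³`.
    have e : (unif ^ 2 + unif) * (1 + (unif ^ 2 + unif) ^ 3) *
        (aeval w p.imI * w + aeval w p.imJ * w ^ 2 + aeval w p.imK * unif ^ 2 * w ^ 2) +
        (aeval w p.imI * (1 + (unif ^ 2 + unif) ^ 3) +
          aeval w p.imJ * (w + (unif ^ 2 + unif) ^ 2) +
          aeval w p.imK * (1 + unif ^ 2) * (w + (unif ^ 2 + unif) ^ 2)) =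
        (w * aeval w p.imK) * (1 + (unif ^ 2 + unif) ^ 3) := by
      generalize unif ^ 2 + unif = u at *
      grind
    have := mul_mem (add_mem (mul_mem (mul_mem hu (add_mem (one_mem O) (pow_mem hu 3))) h10) h01) hk
    convert this using 1
    linear_combination (-(unif ^ m * k)) * e - (unif ^ m * (w * aeval w p.imK)) * hk1
  refine ⟨key _ n₁, key _ (by rwa [map_mul, aeval_X]), key _ ?_, key _ ?_⟩
  · rw [map_add, map_mul, map_pow, aeval_X]
    convert add_mem h11 (add_mem (mul_mem n₁ (pow_mem hunif 2)) (mul_mem n₃ (pow_mem hu 2)))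
      using 1
    generalize unif ^ 2 + unif = u at *
    grind
  · rw [map_add, map_mul, map_mul, map_pow, aeval_X]
    convert add_mem h10 (mul_mem (mul_mem n₃ hunif) hs) using 1
    grind

end Stabilizer

section Main

open Polynomial

/-! ### The stabilizer of the standard vertex -/

theorem quadratic_not_dvd_one_add_X : ¬ (1 + X + X ^ 2 : (ZMod 2)[X]) ∣ 1 + X := by
  intro h
  have h1 := natDegree_le_of_dvd h prime_one_add_X.ne_zero
  rw [natDegree_quadratic] at h1
  have h2 : (1 + X : (ZMod 2)[X]).natDegree ≤ 1 := by compute_degree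
  omega

theorem one_add_X_not_dvd_quadratic : ¬ (1 + X : (ZMod 2)[X]) ∣ 1 + X + X ^ 2 := by
  rw [eval_eq_zero_iff_dvd]
  simp only [eval_add, eval_one, eval_X, eval_pow]
  decide

/-- A polynomial quaternion with invertible image in `𝔒` fixing the standard vertex is a scalar
multiple of `1` or of `D`. -/
theorem eq_smul_of_isVertexMatrix (n : ℕ) (p : Quat (ZMod 2)[X] X) (hn : (nrd p).natDegree = n)
    {k : ℕ} (hk : nrd p ∣ (X * (1 + X ^ 3)) ^ k) (hY : IsVertexMatrix (rhoY (toOrder p)))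
    (hT : IsVertexMatrix (rhoT (toOrder p))) :
    ∃ r : (ZMod 2)[X], p = r • 1 ∨ p = r • ⟨1 + X + X ^ 2, 0, 0, 1⟩ := by
  induction n using Nat.strong_induction_on generalizing p with
  | _ n ih =>
    have h0 : nrd p ≠ 0 := ne_zero_of_dvd_ne_zero (pow_ne_zero k X_mul_one_add_X_cube_ne_zero) hk
    -- Removing a scalar prime factor `q` lowers the degree of the norm by `2 deg q`, and scalars do
    -- not affect the vertex conditions.
    have step : ∀ q : (ZMod 2)[X], Prime q → (∃ p', p = q • p') →
        ∃ r : (ZMod 2)[X], p = r • 1 ∨ p = r • ⟨1 + X + X ^ 2, 0, 0, 1⟩ := by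
      rintro q hq ⟨p', rfl⟩
      rw [nrd_smul] at h0 hk hn
      have hp0 := right_ne_zero_of_mul h0
      rw [natDegree_mul (pow_ne_zero 2 hq.ne_zero) hp0, natDegree_pow] at hn
      have hq1 := hq.irreducible.natDegree_pos
      rw [toOrder_smul, rhoY_smul] at hY
      rw [toOrder_smul, rhoT_smul] at hT
      obtain ⟨r, hr | hr⟩ := ih _ (by omega) p' rfl ((dvd_mul_left _ _).trans hk) hY.of_smul
        hT.of_smul
      · exact ⟨q * r, .inl (by rw [hr, mul_smul])⟩
      · exact ⟨q * r, .inr (by rw [hr, mul_smul])⟩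
    by_cases hX : X ∣ nrd p
    · exact step X prime_X (exists_eq_X_smul hY hX)
    by_cases h1 : (1 + X) ^ 2 ∣ nrd p
    · exact step _ prime_one_add_X (exists_eq_smul_of_sq_dvd_nrd prime_one_add_X one_add_X_cube
        one_add_X_not_dvd_quadratic (fun _ _ => anisotropic_one_add_X) h1)
    by_cases h2 : (1 + X + X ^ 2) ^ 2 ∣ nrd p
    · exact step _ irreducible_quadratic.prime (exists_eq_smul_of_sq_dvd_nrd
        irreducible_quadratic.prime (one_add_X_cube.trans (mul_comm _ _))
        quadratic_not_dvd_one_add_X (fun _ _ => anisotropic_quadratic) h2)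
    have h3 := natDegree_nrd_le hk hX h1 h2
    obtain ⟨m, hm, hint⟩ := exists_natDegree_eq_two_mul hT h0
    obtain ⟨d₁, d₃, d₀, d₂⟩ := degree_bounds hint
    rcases eq_of_degree_bounds (by omega) hm hX h1 d₁ d₃ d₀ d₂ with ⟨r, hr⟩ | hr
    · exact ⟨C r, .inl (by rw [hr]; ext1 <;> simp)⟩
    · exact ⟨1, .inr (by rw [one_smul]; exact hr)⟩

theorem exists_toOrder_eq_smul (x : Order) :
    ∃ (p : Quat (ZMod 2)[X] X) (s : CoeffRing), IsUnit s ∧ toOrder p = s • x := by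
  obtain ⟨s, hs⟩ := IsLocalization.exist_integer_multiples_of_finite
    (Submonoid.powers (X * (1 + X ^ 3) : (ZMod 2)[X])) ![x.re, x.imI, x.imJ, x.imK]
  choose a ha using hs
  refine ⟨⟨a 0, a 1, a 2, a 3⟩, algebraMap _ _ (s : (ZMod 2)[X]),
    IsLocalization.map_units CoeffRing s, ?_⟩
  simp only [Algebra.smul_def] at ha
  ext1
  exacts [ha 0, ha 1, ha 2, ha 3]

theorem mem_fixers_iff {γ : G} :
    γ ∈ fixer rhoYHom ⊓ fixer rhoTHom ↔ γ ∈ Subgroup.zpowers d := by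
  constructor
  · intro h
    obtain ⟨x, rfl⟩ := QuotientGroup.mk_surjective γ
    obtain ⟨p, s, hs, hp⟩ := exists_toOrder_eq_smul x
    have smul_vertex : ∀ {g : Matrix (Fin 2) (Fin 2) LocalField} {k : LocalField}, k ≠ 0 →
        IsVertexMatrix g → IsVertexMatrix (k • g) := by
      rintro g k hk ⟨N, hN, c, hc, rfl⟩
      exact ⟨N, hN, k * c, mul_ne_zero hk hc, smul_smul _ _ _⟩
    have hY : IsVertexMatrix (rhoY (toOrder p)) := by
      rw [hp, rhoY_smul]
      refine smul_vertex (hs.map embY).ne_zero ?_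
      have := (mk_mem_fixer_iff preservesScalars_rhoY).1 h.1
      rwa [rhoYHom_apply, homothetic_stdLattice_iff] at this
    have hT : IsVertexMatrix (rhoT (toOrder p)) := by
      rw [hp, rhoT_smul]
      refine smul_vertex (hs.map embT).ne_zero ?_
      have := (mk_mem_fixer_iff preservesScalars_rhoT).1 h.2
      rwa [rhoTHom_apply, homothetic_stdLattice_iff] at this
    have hu : IsUnit (algebraMap _ CoeffRing (nrd p)) := by
      rw [← nrd_toOrder, hp, nrd_smul]
      exact (hs.pow 2).mul (isUnit_nrd x)
    obtain ⟨k, hk⟩ := (IsLocalization.Away.algebraMap_isUnit_iff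
      (X * (1 + X ^ 3) : (ZMod 2)[X])).1 hu
    obtain ⟨s, rfl⟩ := hs
    have hx : (x : Order) = (s⁻¹ : CoeffRingˣ).val • toOrder p := by
      rw [hp, smul_smul, s.inv_mul, one_smul]
    obtain ⟨r, rfl | rfl⟩ := eq_smul_of_isVertexMatrix _ p rfl hk hY hT
    · have : (QuotientGroup.mk x : G) = 1 := by
        refine mk_eq_mk_of_smul (y := 1) ((s⁻¹ : CoeffRingˣ).val * algebraMap _ _ r) ?_
        rw [hx, toOrder_smul, mul_smul]
        congr 2
        ext1 <;> simp [toOrder]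
      rw [this]
      exact one_mem _
    · have : (QuotientGroup.mk x : G) = d := by
        refine mk_eq_mk_of_smul (y := D) ((s⁻¹ : CoeffRingˣ).val * algebraMap _ _ r) ?_
        rw [hx, toOrder_smul, mul_smul]
        congr 2
        ext1 <;> simp [toOrder, D, unitOfNrd, z]
      rw [this]
      exact Subgroup.mem_zpowers d
  · intro h
    exact (Subgroup.zpowers_le.2 (Subgroup.mem_inf.2 ⟨d_mem_fixer_y, d_mem_fixer_t⟩)) h

/-! ### The semidirect product -/

theorem presentedToG_surjective : Function.Surjective presentedToG := by
  have hs : ∀ s : Gen, s.toG ∈ presentedToG.range := fun s => ⟨_, presentedToG_of s⟩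
  have hLam : Lam ≤ presentedToG.range := by
    rw [Lam, Subgroup.closure_le]
    rintro _ (rfl | rfl | rfl | rfl)
    exacts [hs .b₁, hs .b₂, hs .c₁, hs .c₂]
  intro γ
  obtain ⟨g, hg, h⟩ := exists_mul_mem_fixers γ
  rw [mem_fixers_iff] at h
  have h1 : g * γ ∈ presentedToG.range := (Subgroup.zpowers_le.2 (hs .d)) h
  exact (Subgroup.mul_mem_cancel_left _ (hLam hg)).1 h1

/-- The isomorphism from the presented group to `G(R)`. -/
def presentedEquiv : PresentedGroup relators ≃* G :=
  MulEquiv.ofBijective presentedToG ⟨presentedToG_injective, presentedToG_surjective⟩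

@[simp] theorem presentedEquiv_of (s : Gen) : presentedEquiv (PresentedGroup.of s) = s.toG :=
  presentedToG_of s

/-- The values on the generators of the homomorphism to `ℤ/2` with kernel `Λ`. -/
def Gen.sign : Gen → Multiplicative (ZMod 2)
  | .d => Multiplicative.ofAdd 1
  | _ => 1

/-- The letter `d` occurs an even number of times in each relator. -/
theorem lift_sign_relators : ∀ r ∈ relators, FreeGroup.lift Gen.sign r = 1 := by
  simp only [relators, Set.mem_insert_iff, Set.mem_singleton_iff]
  rintro r (rfl | rfl | rfl | rfl | rfl | rfl | rfl | rfl | rfl | rfl) <;>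
    simp only [map_pow, map_mul, map_inv, FreeGroup.lift_apply_of, Gen.sign] <;> decide

/-- The presentation is what makes the sign a well-defined character of `G(R)`, trivial on `Λ` but
not on `d`. -/
theorem disjoint_Lam : Disjoint Lam (Subgroup.zpowers d) := by
  let χ : G →* Multiplicative (ZMod 2) :=
    (PresentedGroup.toGroup lift_sign_relators).comp presentedEquiv.symm.toMonoidHom
  have hχ : ∀ s : Gen, χ s.toG = s.sign := by
    intro s
    show PresentedGroup.toGroup lift_sign_relators (presentedEquiv.symm s.toG) = _
    rw [← presentedEquiv_of, MulEquiv.symm_apply_apply, PresentedGroup.toGroup.of]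
  have hLam : Lam ≤ χ.ker := by
    rw [Lam, Subgroup.closure_le]
    rintro _ (rfl | rfl | rfl | rfl)
    exacts [hχ .b₁, hχ .b₂, hχ .c₁, hχ .c₂]
  rw [Subgroup.disjoint_def]
  intro x hx hd
  have h1 : χ x = 1 := hLam hx
  obtain ⟨n, rfl⟩ := hd
  simp only at h1 ⊢
  rcases Int.even_or_odd' n with ⟨m, rfl | rfl⟩
  · rw [zpow_mul, zpow_ofNat, d_sq, one_zpow]
  · exfalso
    rw [zpow_add, zpow_mul, zpow_ofNat, d_sq, one_zpow, one_mul, zpow_one] at h1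
    have h2 := (hχ .d).symm.trans h1
    revert h2
    decide

theorem normal_Lam : Lam.Normal := by
  have hd' : d * d = 1 := by rw [← pow_two, d_sq]
  have hdinv : d⁻¹ = d := inv_eq_of_mul_eq_one_left hd'
  have hconj : Lam ≤ Lam.comap (MulAut.conj d).toMonoidHom := by
    conv_lhs => rw [Lam]
    rw [Subgroup.closure_le]
    have hmem : ∀ x ∈ ({b₁, b₂, c₁, c₂} : Set G), x ∈ Lam := fun x hx =>
      Subgroup.subset_closure hx
    rintro x hx
    show d * x * d⁻¹ ∈ Lam
    rw [hdinv]
    rcases hx with rfl | rfl | rfl | rfl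
    · rw [eq_inv_of_mul_eq_one_left d_b₁_d_b₁]; exact inv_mem (hmem _ (by simp))
    · rw [eq_inv_of_mul_eq_one_left d_b₂_d_b₂]; exact inv_mem (hmem _ (by simp))
    · rw [← c₁_mul_d, mul_assoc, hd', mul_one]; exact hmem _ (by simp)
    · rw [← c₂_mul_d, mul_assoc, hd', mul_one]; exact hmem _ (by simp)
  have hdN : d ∈ Subgroup.normalizer (Lam : Set G) := by
    rw [Subgroup.mem_normalizer_iff]
    intro x
    refine ⟨fun hx => hconj hx, fun hx => ?_⟩
    have h1 : d * (d * x * d⁻¹) * d⁻¹ ∈ Lam := hconj hx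
    have h2 : d * (d * x * d⁻¹) * d⁻¹ = (d * d) * x * (d * d) := by
      simp only [hdinv, mul_assoc]
    rwa [h2, hd', one_mul, mul_one] at h1
  rw [← Subgroup.normalizer_eq_top_iff, eq_top_iff]
  intro γ _
  obtain ⟨g, hg, h⟩ := exists_mul_mem_fixers γ
  rw [mem_fixers_iff] at h
  exact (Subgroup.mul_mem_cancel_left _ (Subgroup.le_normalizer hg)).1
    ((Subgroup.zpowers_le.2 hdN) h)

theorem isComplement_Lam : Lam.IsComplement' (Subgroup.zpowers d) := by
  refine Subgroup.isComplement'_of_disjoint_and_mul_eq_univ disjoint_Lam ?_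
  rw [Set.eq_univ_iff_forall]
  intro γ
  obtain ⟨g, hg, h⟩ := exists_mul_mem_fixers γ
  rw [mem_fixers_iff] at h
  exact ⟨g⁻¹, inv_mem hg, g * γ, h, inv_mul_cancel_left g γ⟩

end Main

end QuatLattice

end

theorem mainTheorem3 :
    -- the presentation of `G(R)` on `b₁, b₂, c₁, c₂, d` with the ten relations
    (∃ e : PresentedGroup QuatLattice.relators ≃* QuatLattice.G,
      ∀ s : QuatLattice.Gen, e (PresentedGroup.of s) = s.toG) ∧
    -- `G(R)` is the internal semidirect product of `Λ` and `⟨d⟩`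
    QuatLattice.Lam.Normal ∧
    QuatLattice.Lam.IsComplement' (Subgroup.zpowers QuatLattice.d) ∧
    -- `⟨d⟩` has order two and is the stabilizer of the standard vertex
    orderOf QuatLattice.d = 2 ∧
    (∀ x : QuatLattice.Orderˣ, QuatLattice.FixesStdVertex x ↔
      (QuotientGroup.mk x : QuatLattice.G) ∈ Subgroup.zpowers QuatLattice.d) := by
  exact ⟨⟨QuatLattice.presentedEquiv, QuatLattice.presentedEquiv_of⟩, QuatLattice.normal_Lam,
    QuatLattice.isComplement_Lam, QuatLattice.orderOf_d,
    fun _ => QuatLattice.fixesStdVertex_iff.trans QuatLattice.mem_fixers_iff⟩
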